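/- Consider the decision problem CG Min-Max Dissatisfaction. An instance consists of a number $k$ of agents, a finite directed acyclic graph $G=(V,A)$ whose vertices are the items (an arc $(a,b)$ means that all agents prefer $a$ to $b$), and an integer $d$. An allocation $\pi$ assigns to each agent $i\in\{1,\dots,k\}$ a set $\pi(i)\subseteq V$ of items such that the sets of different agents are disjoint (items may stay unassigned). The dissatisfaction $\delta_\pi(i)$ of agent $i$ is the number of items $v\in V$ such that there is no directed path (of length $\ge 0$) in $G$ from an item of $\pi(i)$ to $v$. The question is whether there is an allocation $\pi$ with $\delta_\pi(i)\le d$ for every agent $i$. The width of $G$ is the maximum cardinality of a set of vertices that are pairwise unreachable from each other by directed paths in $G$. Theorem. Restricted to instances whose preference graph $G$ has width at most $2$, with an arbitrary number $k$ of agents that is part of the input, CG Min-Max Dissatisfaction is solvable in polynomial time. That is, there are a (multi-stack) Turing machine $M$ and a polynomial $p$ such that for every instance $(k,G,d)$ with $w(G)\le 2$, encoded as a word $x$ that consists of $k$ and $d$ in binary and the adjacency matrix of $G$, the machine $M$ halts on input $x$ after at most $p(|x|)$ steps and outputs the correct answer to the question. -/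

import Mathlib

/-! ### Directed graphs: reachability, acyclicity, antichains, width -/

namespace Digraph

/-- `G.Reaches u v`: there is a walk (equivalently, a path) of length `≥ 0` from `u` to `v`. -/
def Reaches {V : Type} (G : Digraph V) (u v : V) : Prop :=
  Relation.ReflTransGen G.Adj u v

/-- `G` has no directed cycle: no vertex lies on a closed walk of positive length.
In particular `G` has no loops. -/
def IsAcyclic {V : Type} (G : Digraph V) : Prop :=
  ∀ v, ¬ Relation.TransGen G.Adj v v

open Classical in
/-- The width of a finite directed graph: the largest cardinality of an antichain, that is, of a
set of vertices that are pairwise unreachable from each other. -/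
noncomputable def width {V : Type} [Fintype V] (G : Digraph V) : ℕ :=
  (Finset.univ.filter fun S : Finset V => IsAntichain G.Reaches (S : Set V)).sup Finset.card

open Classical in
/-- The dissatisfaction, with respect to the preference graph `G`, of an agent who receives the
set `S` of items: the number of items that are not dominated by an item of `S`. Here `v` is
dominated by `u` if there is a path (possibly of length `0`) from `u` to `v`. -/
noncomputable def dissatisfaction {V : Type} [Fintype V] (G : Digraph V) (S : Finset V) : ℕ :=
  (Finset.univ.filter fun v : V => ∀ u ∈ S, ¬ G.Reaches u v).card

end Digraph

/-! ### The decision problem CG Min-Max Dissatisfaction -/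

/-- An instance: a number of agents, items `0, …, items - 1`, an acyclic preference graph on the
items, and an integer `d`. -/
structure CGInstance where
  /-- the number `k` of agents -/
  agents : ℕ
  /-- the number `n` of items -/
  items : ℕ
  /-- the preference graph -/
  graph : Digraph (Fin items)
  /-- the preference graph is a directed acyclic graph -/
  acyclic : graph.IsAcyclic
  /-- the bound `d` on the dissatisfaction -/
  bound : ℤ

namespace CGInstance

/-- The question: is there an allocation, i.e. an assignment of pairwise disjoint sets of items to
the agents (items may stay unassigned), under which every agent has dissatisfaction at most `d`? -/
def IsYes (I : CGInstance) : Prop :=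
  ∃ π : Fin I.agents → Finset (Fin I.items),
    Pairwise (fun i j => Disjoint (π i) (π j)) ∧
      ∀ i, (I.graph.dissatisfaction (π i) : ℤ) ≤ I.bound

open Computability in
/-- The binary representation of a natural number, least significant bit first. -/
def natWord (m : ℕ) : List Γ' := (encodeNat m).map Γ'.bit

open Computability in
/-- The binary representation of an integer: a sign bit, followed by the absolute value. -/
def intWord (m : ℤ) : List Γ' := Γ'.bit (decide (m < 0)) :: natWord m.natAbs

open Classical Computability in
/-- The adjacency matrix of a directed graph, row by row, each row followed by a comma. -/
noncomputable def graphWord {n : ℕ} (G : Digraph (Fin n)) : List Γ' :=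
  (List.finRange n).flatMap fun u =>
    ((List.finRange n).map fun v => Γ'.bit (decide (G.Adj u v))) ++ [Γ'.comma]

open Computability in
/-- The input word of an instance: `k` and `d` in binary, each followed by a comma, and then the
adjacency matrix of the preference graph. -/
noncomputable def word (I : CGInstance) : List Γ' :=
  natWord I.agents ++ [Γ'.comma] ++ intWord I.bound ++ [Γ'.comma] ++ graphWord I.graph

end CGInstance

/-! ### Polynomial-time solvability -/

open Classical in
/-- The decision problem with instances `a : α`, given to the machine as the words `enc a`, and
question `P a`, is solvable in polynomial time: there are one multi-stack Turing machine and one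
polynomial `p` such that on every input `enc a` the machine halts after at most `p |enc a|` steps
with the correct answer to `P a` as output. -/
def SolvableInPolyTime {α Γ : Type} (enc : α → List Γ) (P : α → Prop) : Prop :=
  Nonempty (Turing.TM2ComputableInPolyTime enc Computability.encodeBool fun a => decide (P a))

/-! Call a set of items good if it leaves at most `d` items undominated. An instance of width at
most two is positive if and only if every set `S` of at most two items is good or leaves at least
`k` items undominated.

Necessity needs no bound on the width or on `S` (`Digraph.le_dissatisfaction_of_allocation`). If `S`
is not good, it cannot dominate a whole bundle `π i`, because it would then dominate all that `π i`
dominates and be good itself. So every bundle contains an item that `S` misses, and these `k` items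
are distinct since the bundles are disjoint.

Sufficiency (`Digraph.exists_allocation_of_le_dissatisfaction`) uses a cover by two chains
(`Finset.exists_two_chains`), each sorted from the most preferred item downwards. Agent `i` receives
the item at position `i` of the first chain and the item at position `k - 1 - i` of the second. Only
items before these positions can be undominated, hence at most `k - 1` of them, and the criterion
forces the pair to be good.

The criterion inspects only quadratically many sets. Its evaluation is written as a loop program
whose loops are all bounded by read-only registers; such a program takes polynomial time by a single
induction on its syntax (`LoopProg.exec_compile`). Loop programs are translated to structured stack
programs, and these to multi-stack machines (`StackProg.Exec.iterate_step`). Reachability is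
computed by Warshall's algorithm. The numbers `k` and `d` may be exponential in the input length,
but they are only compared with numbers of items, so they are truncated just above the number of
items while being read. -/

/-! ### Two chains covering a poset of width at most two -/

/-- A finite set without antichains of three elements is the disjoint union of two chains. -/
theorem Finset.exists_two_chains {α : Type*} [PartialOrder α] [DecidableEq α] (s : Finset α)
    (hs : ∀ t : Finset α, t ⊆ s → IsAntichain (· ≤ ·) (t : Set α) → t.card ≤ 2) :
    ∃ A B : Finset α, A ∪ B = s ∧ Disjoint A B ∧
      IsChain (· ≤ ·) (A : Set α) ∧ IsChain (· ≤ ·) (B : Set α) := by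
  classical
  induction hn : s.card generalizing s with
  | zero =>
    rw [Finset.card_eq_zero] at hn
    subst hn
    exact ⟨∅, ∅, by simp, by simp, by simp, by simp⟩
  | succ n ih =>
    have hne : s.Nonempty := Finset.card_pos.1 (by omega)
    -- Induction by removal of a maximal element `x`, which then has to be fitted into the chains
    -- `A` and `B` that cover the rest.
    obtain ⟨x, hx⟩ := s.exists_maximal hne
    obtain ⟨A, B, hAB, hdis, hA, hB⟩ := ih (s.erase x)
      (fun t ht => hs t (ht.trans (Finset.erase_subset _ _)))
      (by rw [Finset.card_erase_of_mem hx.prop, hn]; rfl)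
    have hmem : ∀ y, y ∈ A ∨ y ∈ B ↔ y ≠ x ∧ y ∈ s := fun y => by
      rw [← Finset.mem_union, hAB, Finset.mem_erase]
    have hnx : ∀ y, y ∈ A ∨ y ∈ B → y ≠ x := fun y hy => ((hmem y).1 hy).1
    have htot : ∀ {C : Finset α}, IsChain (· ≤ ·) (C : Set α) → ∀ {y z}, y ∈ C → z ∈ C →
        y ≤ z ∨ z ≤ y := fun hC y z hy hz => hC.total (by simpa using hy) (by simpa using hz)
    by_cases hcomp : ∀ a ∈ A, ∀ b ∈ B, a ≤ b ∨ b ≤ a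
    · refine ⟨s.erase x, {x}, ?_, by simp, ?_, by simp⟩
      · rw [Finset.union_comm]; exact Finset.insert_erase hx.prop
      · rw [← hAB]
        intro y hy z hz _
        simp only [Finset.coe_union, Set.mem_union, Finset.mem_coe] at hy hz
        rcases hy with hy | hy <;> rcases hz with hz | hz
        · exact htot hA hy hz
        · exact hcomp _ hy _ hz
        · exact (hcomp _ hz _ hy).symm
        · exact htot hB hy hz
    · push Not at hcomp
      obtain ⟨a₀, ha₀, b₀, hb₀, h₁, h₂⟩ := hcomp
      -- In each chain, take the highest element that is incomparable to some element of the other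
      -- chain. Everything above it is comparable to the whole other chain.
      obtain ⟨a, ha⟩ := (A.filter fun a => ∃ b ∈ B, ¬ a ≤ b ∧ ¬ b ≤ a).exists_maximal
        ⟨a₀, by simp only [Finset.mem_filter]; exact ⟨ha₀, b₀, hb₀, h₁, h₂⟩⟩
      obtain ⟨b, hb⟩ := (B.filter fun b => ∃ a ∈ A, ¬ a ≤ b ∧ ¬ b ≤ a).exists_maximal
        ⟨b₀, by simp only [Finset.mem_filter]; exact ⟨hb₀, a₀, ha₀, h₁, h₂⟩⟩
      have haA := (Finset.mem_filter.1 ha.prop).1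
      have hbB := (Finset.mem_filter.1 hb.prop).1
      have hamax : ∀ c ∈ A, (∃ b ∈ B, ¬ c ≤ b ∧ ¬ b ≤ c) → c ≤ a := fun c hc h =>
        (htot hA hc haA).elim id fun h' => ha.2 (Finset.mem_filter.2 ⟨hc, h⟩) h'
      have hbmax : ∀ c ∈ B, (∃ a ∈ A, ¬ a ≤ c ∧ ¬ c ≤ a) → c ≤ b := fun c hc h =>
        (htot hB hc hbB).elim id fun h' => hb.2 (Finset.mem_filter.2 ⟨hc, h⟩) h'
      obtain ⟨y, hy, hay, hya⟩ := (Finset.mem_filter.1 ha.prop).2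
      obtain ⟨z, hz, hzb, hbz⟩ := (Finset.mem_filter.1 hb.prop).2
      -- The two elements are incomparable to each other: `b` has an incomparable partner `z` in
      -- `A`, and `z ≤ a`, so `a ≤ b` would give `z ≤ b`.
      have hab : ¬ a ≤ b := fun h => hzb ((hamax z hz ⟨b, hbB, hzb, hbz⟩).trans h)
      have hba : ¬ b ≤ a := fun h => hya ((hbmax y hy ⟨a, haA, hay, hya⟩).trans h)
      have hxmax : ∀ y, y ∈ A ∨ y ∈ B → ¬ x ≤ y := fun y hy h =>
        hnx y hy (le_antisymm (hx.2 ((hmem y).1 hy).2 h) h)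
      -- Otherwise `{a, b, x}` is an antichain of three elements, since the maximal `x` lies below
      -- neither `a` nor `b`.
      have key : a ≤ x ∨ b ≤ x := by
        by_contra hcon
        push Not at hcon
        have hax := hnx a (Or.inl haA)
        have hbx := hnx b (Or.inr hbB)
        have hne : a ≠ b := fun h => hab h.le
        have := hs {a, b, x} (by
          intro c hc
          simp only [Finset.mem_insert, Finset.mem_singleton] at hc
          rcases hc with rfl | rfl | rfl
          · exact ((hmem _).1 (Or.inl haA)).2
          · exact ((hmem _).1 (Or.inr hbB)).2
          · exact hx.prop) (by
          intro c hc e he hce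
          simp only [Finset.coe_insert, Finset.coe_singleton, Set.mem_insert_iff,
            Set.mem_singleton_iff] at hc he
          rcases hc with rfl | rfl | rfl <;> rcases he with rfl | rfl | rfl
          · exact absurd rfl hce
          · exact hab
          · exact hcon.1
          · exact hba
          · exact absurd rfl hce
          · exact hcon.2
          · exact hxmax _ (Or.inl haA)
          · exact hxmax _ (Or.inr hbB)
          · exact absurd rfl hce)
        rw [Finset.card_eq_three.2 ⟨a, b, x, hne, hax, hbx, rfl⟩] at this
        omega
      -- If `c ≤ x`, the part of `C` up to `c` is extended by `x`, and the part of `C` above `c`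
      -- moves to `D`, with which it is comparable by the choice of `c`. Stated for general `C`, `D`
      -- so that it serves both cases of `key`.
      have main : ∀ {C D : Finset α} {c : α}, (∀ y, y ∈ C ∨ y ∈ D ↔ y ≠ x ∧ y ∈ s) →
          Disjoint C D → IsChain (· ≤ ·) (C : Set α) → IsChain (· ≤ ·) (D : Set α) →
          (∀ y ∈ C, (∃ b ∈ D, ¬ y ≤ b ∧ ¬ b ≤ y) → y ≤ c) → c ≤ x →
          ∃ A B : Finset α, A ∪ B = s ∧ Disjoint A B ∧
            IsChain (· ≤ ·) (A : Set α) ∧ IsChain (· ≤ ·) (B : Set α) := by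
        intro C D c hmem hdis hC hD hmax hcx
        refine ⟨insert x (C.filter (· ≤ c)), D ∪ C.filter (¬ · ≤ c), ?_, ?_, ?_, ?_⟩
        · ext y
          have := hmem y
          simp only [Finset.mem_union, Finset.mem_insert, Finset.mem_filter]
          by_cases hyx : y = x
          · subst hyx; simp [hx.prop]
          · by_cases hyc : y ≤ c <;> simp [hyx, hyc] at this ⊢ <;> tauto
        · rw [Finset.disjoint_left]
          intro y hy hy'
          simp only [Finset.mem_union, Finset.mem_insert, Finset.mem_filter] at hy hy'
          rcases hy with rfl | hy
          · exact ((hmem y).1 (by tauto)).1 rfl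
          · rcases hy' with hy' | hy'
            · exact Finset.disjoint_left.1 hdis hy.1 hy'
            · exact hy'.2 hy.2
        · intro y hy z hz _
          simp only [Finset.coe_insert, Finset.coe_filter, Set.mem_insert_iff,
            Set.mem_ofPred_eq] at hy hz
          rcases hy with rfl | hy <;> rcases hz with rfl | hz
          · exact Or.inl le_rfl
          · exact Or.inr (hz.2.trans hcx)
          · exact Or.inl (hy.2.trans hcx)
          · exact htot hC hy.1 hz.1
        · intro y hy z hz _
          simp only [Finset.coe_union, Finset.coe_filter, Set.mem_union, Finset.mem_coe,
            Set.mem_ofPred_eq] at hy hz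
          have hCD : ∀ y z, y ∈ D → z ∈ C → ¬ z ≤ c → y ≤ z ∨ z ≤ y := by
            intro y z hy hz hzc
            by_contra hcon
            push Not at hcon
            exact hzc (hmax z hz ⟨y, hy, hcon.2, hcon.1⟩)
          rcases hy with hy | hy <;> rcases hz with hz | hz
          · exact htot hD hy hz
          · exact hCD _ _ hy hz.1 hz.2
          · exact (hCD _ _ hz hy.1 hy.2).symm
          · exact htot hC hy.1 hz.1
      rcases key with h | h
      · exact main hmem hdis hA hB hamax h
      · refine main (fun y => by rw [or_comm]; exact hmem y) hdis.symm hB hA ?_ h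
        rintro c hc ⟨a, ha, h⟩
        exact hbmax c hc ⟨a, ha, h.2, h.1⟩

/-- The elements of a finite chain, in increasing order. -/
theorem Finset.exists_pairwise_lt_list {α : Type*} [PartialOrder α] [DecidableEq α] (A : Finset α)
    (hA : IsChain (· ≤ ·) (A : Set α)) :
    ∃ l : List α, l.Pairwise (· < ·) ∧ ∀ x, x ∈ l ↔ x ∈ A := by
  induction hn : A.card generalizing A with
  | zero =>
    rw [Finset.card_eq_zero] at hn
    subst hn
    exact ⟨[], by simp⟩
  | succ n ih =>
    obtain ⟨x, hx⟩ := A.exists_minimal (Finset.card_pos.1 (by omega))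
    obtain ⟨l, hl, hmem⟩ := ih (A.erase x) (hA.mono (by simp))
      (by rw [Finset.card_erase_of_mem hx.prop, hn]; rfl)
    refine ⟨x :: l, List.pairwise_cons.2 ⟨fun y hy => ?_, hl⟩, fun y => ?_⟩
    · obtain ⟨hyx, hyA⟩ := Finset.mem_erase.1 ((hmem y).1 hy)
      refine lt_of_le_of_ne ?_ (Ne.symm hyx)
      exact (hA.total (by simpa using hx.prop) (by simpa using hyA)).elim id fun h => hx.2 hyA h
    · rw [List.mem_cons, hmem, Finset.mem_erase]
      by_cases h : y = x
      · simp [h, hx.prop]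
      · simp [h]

/-! ### Allocations of bounded dissatisfaction in graphs of width at most two -/

namespace Digraph

variable {V : Type} [Fintype V] {G : Digraph V}

theorem dissatisfaction_le_of_forall_reaches {S T : Finset V}
    (h : ∀ u ∈ S, ∃ v ∈ T, G.Reaches v u) : G.dissatisfaction T ≤ G.dissatisfaction S := by
  classical
  refine Finset.card_le_card fun w hw => ?_
  simp only [Finset.mem_filter, Finset.mem_univ, true_and] at hw ⊢
  intro u hu huw
  obtain ⟨v, hv, hvu⟩ := h u hu
  exact hw v hv (hvu.trans huw)

/-- If all of `k` agents are content with disjoint sets, then a set that would not content an agent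
leaves at least `k` items undominated. -/
theorem le_dissatisfaction_of_allocation {k : ℕ} {d : ℤ} (π : Fin k → Finset V)
    (hdis : Pairwise fun i j => Disjoint (π i) (π j))
    (hπ : ∀ i, (G.dissatisfaction (π i) : ℤ) ≤ d) (S : Finset V)
    (hS : ¬ (G.dissatisfaction S : ℤ) ≤ d) : k ≤ G.dissatisfaction S := by
  classical
  have h : ∀ i, ∃ u ∈ π i, ∀ v ∈ S, ¬ G.Reaches v u := by
    intro i
    by_contra hcon
    push Not at hcon
    exact hS ((Int.ofNat_le.2 (dissatisfaction_le_of_forall_reaches hcon)).trans (hπ i))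
  choose f hf hfS using h
  have hinj : Function.Injective f := by
    intro i j hij
    by_contra hne
    exact Finset.disjoint_left.1 (hdis hne) (hf i) (hij ▸ hf j)
  calc k = (Finset.univ.image f).card := by
        rw [Finset.card_image_of_injective _ hinj, Finset.card_univ, Fintype.card_fin]
    _ ≤ _ := by
        refine Finset.card_le_card fun w hw => ?_
        obtain ⟨i, -, rfl⟩ := Finset.mem_image.1 hw
        simpa using hfS i

/-- The sufficient half of the criterion: bundles made of one item from each chain, at positions
that sum to `k - 1`, leave fewer than `k` items undominated. -/
theorem exists_allocation_of_le_dissatisfaction (hG : G.IsAcyclic) (hw : G.width ≤ 2) {k : ℕ}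
    {d : ℤ} (h₀ : (G.dissatisfaction ∅ : ℤ) ≤ d ∨ k ≤ G.dissatisfaction ∅)
    (h₂ : ∀ S : Finset V, (∃ u v, ∀ w, w ∈ S ↔ w = u ∨ w = v) →
      (G.dissatisfaction S : ℤ) ≤ d ∨ k ≤ G.dissatisfaction S) :
    ∃ π : Fin k → Finset V, (Pairwise fun i j => Disjoint (π i) (π j)) ∧
      ∀ i, (G.dissatisfaction (π i) : ℤ) ≤ d := by
  classical
  let _ : PartialOrder V :=
    { le := G.Reaches
      le_refl := fun _ => Relation.ReflTransGen.refl
      le_trans := fun _ _ _ => Relation.ReflTransGen.trans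
      le_antisymm := fun u v huv hvu => by
        rcases Relation.reflTransGen_iff_eq_or_transGen.1 huv with h | h
        · exact h.symm
        · exact absurd (h.trans_left hvu) (hG u) }
  have hle : ∀ u v : V, u ≤ v ↔ G.Reaches u v := fun _ _ => Iff.rfl
  obtain ⟨A, B, hAB, hdis, hA, hB⟩ := (Finset.univ : Finset V).exists_two_chains (by
    intro t _ ht
    refine le_trans ?_ hw
    exact Finset.le_sup (f := Finset.card) (Finset.mem_filter.2 ⟨Finset.mem_univ _, ht⟩))
  obtain ⟨l, hl, hlA⟩ := A.exists_pairwise_lt_list hA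
  obtain ⟨m, hm, hmB⟩ := B.exists_pairwise_lt_list hB
  -- A position beyond the end of a chain contributes no item, so a bundle may have two, one or no
  -- items. In the last cases the chain is too short to violate the count below.
  let pair : ℕ → ℕ → Finset V := fun p q => l[p]?.toFinset ∪ m[q]?.toFinset
  have hpair : ∀ p q v, v ∈ pair p q ↔ l[p]? = some v ∨ m[q]? = some v := by
    intro p q v
    simp only [pair, Finset.mem_union, Option.mem_toFinset, Option.mem_def]
  have htake : ∀ {l : List V} (p : ℕ), l.Pairwise (· < ·) → ∀ v ∈ l, v ∈ (l.take p).toFinset ∨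
      ∃ u, l[p]? = some u ∧ u ≤ v := by
    intro l p hl v hv
    obtain ⟨i, hi, rfl⟩ := List.mem_iff_getElem.1 hv
    rcases lt_trichotomy i p with h | rfl | h
    · exact Or.inl (List.mem_toFinset.2 (List.mem_iff_getElem.2
        ⟨i, by rw [List.length_take]; omega, by rw [List.getElem_take]⟩))
    · exact Or.inr ⟨_, List.getElem?_eq_getElem hi, le_rfl⟩
    · exact Or.inr ⟨_, List.getElem?_eq_getElem (h.trans hi),
        (List.pairwise_iff_getElem.1 hl p i (h.trans hi) hi h).le⟩
  -- An item at or after the chosen position of its own chain is dominated, so the undominated items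
  -- lie among the first `p` and the first `q`.
  have hcard : ∀ p q, G.dissatisfaction (pair p q) ≤ p + q := by
    intro p q
    calc G.dissatisfaction (pair p q) ≤ ((l.take p).toFinset ∪ (m.take q).toFinset).card := by
          refine Finset.card_le_card fun v hv => ?_
          simp only [Finset.mem_filter, Finset.mem_univ, true_and] at hv
          have hvAB : v ∈ A ∪ B := hAB ▸ Finset.mem_univ v
          rcases Finset.mem_union.1 hvAB with h | h
          · rcases htake p hl v ((hlA v).2 h) with h | ⟨u, hu, huv⟩
            · exact Finset.mem_union_left _ h
            · exact absurd huv (hv u ((hpair p q u).2 (Or.inl hu)))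
          · rcases htake q hm v ((hmB v).2 h) with h | ⟨u, hu, huv⟩
            · exact Finset.mem_union_right _ h
            · exact absurd huv (hv u ((hpair p q u).2 (Or.inr hu)))
      _ ≤ p + q := (Finset.card_union_le _ _).trans (Nat.add_le_add
          ((List.toFinset_card_le _).trans (List.length_take_le _ _))
          ((List.toFinset_card_le _).trans (List.length_take_le _ _)))
  have hgood : ∀ p q, p + q < k → (G.dissatisfaction (pair p q) : ℤ) ≤ d := by
    intro p q hpq
    have hnot : ¬ k ≤ G.dissatisfaction (pair p q) := fun h => by have := hcard p q; omega
    rcases hp : l[p]? with - | u <;> rcases hq : m[q]? with - | v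
    · have : pair p q = ∅ := Finset.eq_empty_of_forall_notMem fun w hw => by
        simp [hpair, hp, hq] at hw
      rw [this] at hnot ⊢
      exact h₀.resolve_right hnot
    · exact (h₂ _ ⟨v, v, fun w => by simp [hpair, hp, hq, eq_comm]⟩).resolve_right hnot
    · exact (h₂ _ ⟨u, u, fun w => by simp [hpair, hp, hq, eq_comm]⟩).resolve_right hnot
    · exact (h₂ _ ⟨u, v, fun w => by simp [hpair, hp, hq, eq_comm]⟩).resolve_right hnot
  have hidx : ∀ {l : List V}, l.Pairwise (· < ·) → ∀ {i j : ℕ} {v : V}, l[i]? = some v → l[j]? = some v →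
      i = j := by
    intro l hl i j v hi hj
    have hnd : l.Nodup := hl.imp fun h => h.ne
    obtain ⟨hi', rfl⟩ := List.getElem?_eq_some_iff.1 hi
    obtain ⟨hj', h⟩ := List.getElem?_eq_some_iff.1 hj
    exact ((hnd.getElem_inj_iff (hi := hj') (hj := hi')).1 h).symm
  -- Both `i` and `k - 1 - i` are injective in `i < k`, and the chains are disjoint, so no item is
  -- given away twice.
  refine ⟨fun i => pair i (k - 1 - i), fun i j hij => ?_, fun i => hgood _ _ (by omega)⟩
  have hij' : (i : ℕ) ≠ j := fun h => hij (Fin.ext h)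
  refine Finset.disjoint_left.2 fun v hi hj => ?_
  have hnot : v ∈ l → v ∈ m → False := fun h h' =>
    Finset.disjoint_left.1 hdis ((hlA v).1 h) ((hmB v).1 h')
  rcases (hpair _ _ _).1 hi with hi | hi <;> rcases (hpair _ _ _).1 hj with hj | hj
  · exact hij' (hidx hl hi hj)
  · exact hnot (List.mem_of_getElem? hi) (List.mem_of_getElem? hj)
  · exact hnot (List.mem_of_getElem? hj) (List.mem_of_getElem? hi)
  · have := hidx hm hi hj
    omega

end Digraph

/-! ### Structured stack programs -/

/-- The configurations of structured programs: an input word, which can only be consumed, and stacks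
of bits. -/
abbrev Stacks (A K : Type) : Type := List A × (K → List Bool)

/-- Structured programs on stacks. -/
inductive StackProg (A K : Type) : Type
  | skip
  | push (k : K) (b : Bool)
  | pop (k : K)
  | popIn
  | seq (P Q : StackProg A K)
  | ite (k : K) (p : Option Bool → Bool) (P Q : StackProg A K)
  | iteIn (p : Option A → Bool) (P Q : StackProg A K)
  | loop (k : K) (p : Option Bool → Bool) (P : StackProg A K)
  | loopIn (p : Option A → Bool) (P : StackProg A K)

namespace StackProg

variable {A K : Type} [DecidableEq K]

/-- `Exec P S S' t`: started with the stacks `S`, the program `P` stops after `t` steps with the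
stacks `S'`. -/
inductive Exec : StackProg A K → Stacks A K → Stacks A K → ℕ → Prop
  | skip (S) : Exec skip S S 1
  | push (k b) (S : Stacks A K) : Exec (push k b) S (S.1, Function.update S.2 k (b :: S.2 k)) 1
  | pop (k) (S : Stacks A K) : Exec (pop k) S (S.1, Function.update S.2 k (S.2 k).tail) 1
  | popIn (S : Stacks A K) : Exec popIn S (S.1.tail, S.2) 1
  | seq {P Q S S' S'' t t'} : Exec P S S' t → Exec Q S' S'' t' → Exec (seq P Q) S S'' (t + t')
  | ite_true {k p P Q} {S S' : Stacks A K} {t} :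
      p (S.2 k).head? = true → Exec P S S' t → Exec (ite k p P Q) S S' (1 + t)
  | ite_false {k p P Q} {S S' : Stacks A K} {t} :
      p (S.2 k).head? = false → Exec Q S S' t → Exec (ite k p P Q) S S' (1 + t)
  | iteIn_true {p P Q} {S S' : Stacks A K} {t} :
      p S.1.head? = true → Exec P S S' t → Exec (iteIn p P Q) S S' (1 + t)
  | iteIn_false {p P Q} {S S' : Stacks A K} {t} :
      p S.1.head? = false → Exec Q S S' t → Exec (iteIn p P Q) S S' (1 + t)
  | loop_true {k p P} {S S' S'' : Stacks A K} {t t'} : p (S.2 k).head? = true →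
      Exec P S S' t → Exec (loop k p P) S' S'' t' → Exec (loop k p P) S S'' (1 + t + t')
  | loop_false {k p P} {S : Stacks A K} : p (S.2 k).head? = false → Exec (loop k p P) S S 1
  | loopIn_true {p P} {S S' S'' : Stacks A K} {t t'} : p S.1.head? = true →
      Exec P S S' t → Exec (loopIn p P) S' S'' t' → Exec (loopIn p P) S S'' (1 + t + t')
  | loopIn_false {p P} {S : Stacks A K} : p S.1.head? = false → Exec (loopIn p P) S S 1

/-! ### Compilation of structured stack programs to multi-stack Turing machines -/

/-- The labels of the machine for a structured program. -/
def Label : StackProg A K → Type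
  | skip | push _ _ | pop _ | popIn => Unit
  | seq P Q => Label P ⊕ Label Q
  | ite _ _ P Q | iteIn _ P Q => Option (Label P ⊕ Label Q)
  | loop _ _ P | loopIn _ P => Option (Label P)

instance fintypeLabel : (P : StackProg A K) → Fintype (Label P)
  | skip | push _ _ | pop _ | popIn => inferInstanceAs (Fintype Unit)
  | seq P Q =>
    let _ := fintypeLabel P
    let _ := fintypeLabel Q
    inferInstanceAs (Fintype (Label P ⊕ Label Q))
  | ite _ _ P Q | iteIn _ P Q =>
    let _ := fintypeLabel P
    let _ := fintypeLabel Q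
    inferInstanceAs (Fintype (Option (Label P ⊕ Label Q)))
  | loop _ _ P | loopIn _ P =>
    let _ := fintypeLabel P
    inferInstanceAs (Fintype (Option (Label P)))

/-- The label at which the machine for a structured program starts. -/
def entry : (P : StackProg A K) → Label P
  | skip | push _ _ | pop _ | popIn => ()
  | seq P _ => Sum.inl (entry P)
  | ite _ _ _ _ | iteIn _ _ _ | loop _ _ _ | loopIn _ _ => none

/-- The alphabets of the machine: the input stack and the stacks of bits. -/
abbrev Sym (A K : Type) : Option K → Type
  | none => A
  | some _ => Bool

/-- The stacks of the machine. -/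
def stk (S : Stacks A K) : (o : Option K) → List (Sym A K o)
  | none => S.1
  | some k => S.2 k

open Turing.TM2 in
/-- The statements of the machine for a structured program, as a part of a machine with labels
`Λ`, which continues at the label `exit`. -/
def code {Λ : Type} : (P : StackProg A K) → (Label P → Λ) → Λ → Label P →
    Turing.TM2.Stmt (Sym A K) Λ Bool
  | skip, _, exit => fun _ => Stmt.goto fun _ => exit
  | push k b, _, exit => fun _ => Stmt.push (some k) (fun _ => b) (Stmt.goto fun _ => exit)
  | pop k, _, exit => fun _ => Stmt.pop (some k) (fun v _ => v) (Stmt.goto fun _ => exit)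
  | popIn, _, exit => fun _ => Stmt.pop none (fun v _ => v) (Stmt.goto fun _ => exit)
  | seq P Q, emb, exit => Sum.elim (code P (fun l => emb (.inl l)) (emb (.inr (entry Q))))
      (code Q (fun l => emb (.inr l)) exit)
  | ite k p P Q, emb, exit => fun
    | none => Stmt.peek (some k) (fun _ o => p o) (Stmt.branch id (Stmt.goto fun _ => emb (some (.inl (entry P))))
        (Stmt.goto fun _ => emb (some (.inr (entry Q)))))
    | some (.inl l) => code P (fun l => emb (some (.inl l))) exit l
    | some (.inr l) => code Q (fun l => emb (some (.inr l))) exit l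
  | iteIn p P Q, emb, exit => fun
    | none => Stmt.peek none (fun _ o => p o) (Stmt.branch id (Stmt.goto fun _ => emb (some (.inl (entry P))))
        (Stmt.goto fun _ => emb (some (.inr (entry Q)))))
    | some (.inl l) => code P (fun l => emb (some (.inl l))) exit l
    | some (.inr l) => code Q (fun l => emb (some (.inr l))) exit l
  | loop k p P, emb, exit => fun
    | none => Stmt.peek (some k) (fun _ o => p o) (Stmt.branch id (Stmt.goto fun _ => emb (some (entry P)))
        (Stmt.goto fun _ => exit))
    | some l => code P (fun l => emb (some l)) (emb none) l
  | loopIn p P, emb, exit => fun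
    | none => Stmt.peek none (fun _ o => p o) (Stmt.branch id (Stmt.goto fun _ => emb (some (entry P)))
        (Stmt.goto fun _ => exit))
    | some l => code P (fun l => emb (some l)) (emb none) l

/-! ### Simulation of structured programs by machines -/

theorem update_stk_some (S : Stacks A K) (k : K) (l : List Bool) :
    Function.update (β := fun o => List (Sym A K o)) (stk S) (some k) l =
      stk (S.1, Function.update S.2 k l) := by
  funext o
  rcases o with - | k'
  · exact Function.update_of_ne (by simp) _ _
  · by_cases h : k' = k
    · subst h
      exact (Function.update_self _ _ _).trans (Function.update_self k' l S.2).symm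
    · refine (Function.update_of_ne (by simpa using h) _ _).trans ?_
      change S.2 k' = Function.update S.2 k l k'
      rw [Function.update_of_ne h]

theorem update_stk_none (S : Stacks A K) (l : List A) :
    Function.update (β := fun o => List (Sym A K o)) (stk S) none l = stk (l, S.2) := by
  funext o
  rcases o with - | k'
  · exact Function.update_self _ _ _
  · exact Function.update_of_ne (by simp) _ _

/-- Induction on the run. The embedding of labels and the exit label stay general, because a
subprogram exits to the entry of its successor, and a loop body exits to the head of its loop. The
internal state `v` is arbitrary, since every test overwrites it before branching on it. -/
theorem Exec.iterate_step {P : StackProg A K} {S S' : Stacks A K} {t : ℕ} (h : Exec P S S' t)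
    {Λ : Type} (M : Λ → Turing.TM2.Stmt (Sym A K) Λ Bool) (emb : Label P → Λ) (exit : Λ)
    (hM : ∀ l, M (emb l) = code P emb exit l) (v : Bool) :
    ∃ v', (flip bind (Turing.TM2.step M))^[t] (some ⟨some (emb (entry P)), v, stk S⟩) =
      some ⟨some exit, v', stk S'⟩ := by
  have first : ∀ (P : StackProg A K) (emb : Label P → Λ) (exit : Λ) (v : Bool) (S : Stacks A K),
      (∀ l, M (emb l) = code P emb exit l) →
      flip bind (Turing.TM2.step M) (some ⟨some (emb (entry P)), v, stk S⟩) =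
        some (Turing.TM2.stepAux (code P emb exit (entry P)) v (stk S)) :=
    fun P emb exit v S hM =>
      congrArg (fun q => some (Turing.TM2.stepAux q v (stk S))) (hM (entry P))
  have cond_eq : ∀ {b c : Bool} (x y : Turing.TM2.Cfg (Sym A K) Λ Bool), b = c →
      some (cond b x y) = some (cond c x y) := by
    rintro b c x y rfl
    rfl
  induction h generalizing exit v with
  | skip S => exact ⟨v, first _ emb exit v S hM⟩
  | push k b S =>
    exact ⟨v, (first _ emb exit v S hM).trans
      (congrArg (fun T => some (Turing.TM2.Cfg.mk (some exit) v T)) (update_stk_some S k (b :: S.2 k)))⟩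
  | pop k S =>
    exact ⟨v, (first _ emb exit v S hM).trans
      (congrArg (fun T => some (Turing.TM2.Cfg.mk (some exit) v T)) (update_stk_some S k (S.2 k).tail))⟩
  | popIn S =>
    exact ⟨v, (first _ emb exit v S hM).trans
      (congrArg (fun T => some (Turing.TM2.Cfg.mk (some exit) v T)) (update_stk_none S S.1.tail))⟩
  | @seq P Q _ _ _ _ _ _ _ ih₁ ih₂ =>
    obtain ⟨v₁, h₁⟩ := ih₁ (fun l => emb (.inl l)) (emb (.inr (entry Q)))
      (fun l => hM (.inl l)) v
    obtain ⟨v₂, h₂⟩ := ih₂ (fun l => emb (.inr l)) exit (fun l => hM (.inr l)) v₁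
    refine ⟨v₂, ?_⟩
    rw [add_comm, Function.iterate_add_apply]
    exact (congrArg _ h₁).trans h₂
  | ite_true hp _ ih =>
    obtain ⟨v₁, h₁⟩ := ih (fun l => emb (some (.inl l))) exit (fun l => hM (some (.inl l))) true
    refine ⟨v₁, ?_⟩
    rw [add_comm, Function.iterate_add_apply, ← h₁]
    refine congrArg _ ((first _ emb exit v _ hM).trans ((cond_eq _ _ hp).trans ?_))
    simp only [stk, hp]
    rfl
  | ite_false hp _ ih =>
    obtain ⟨v₁, h₁⟩ := ih (fun l => emb (some (.inr l))) exit (fun l => hM (some (.inr l))) false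
    refine ⟨v₁, ?_⟩
    rw [add_comm, Function.iterate_add_apply, ← h₁]
    refine congrArg _ ((first _ emb exit v _ hM).trans ((cond_eq _ _ hp).trans ?_))
    simp only [stk, hp]
    rfl
  | iteIn_true hp _ ih =>
    obtain ⟨v₁, h₁⟩ := ih (fun l => emb (some (.inl l))) exit (fun l => hM (some (.inl l))) true
    refine ⟨v₁, ?_⟩
    rw [add_comm, Function.iterate_add_apply, ← h₁]
    refine congrArg _ ((first _ emb exit v _ hM).trans ((cond_eq _ _ hp).trans ?_))
    simp only [stk, hp]
    rfl
  | iteIn_false hp _ ih =>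
    obtain ⟨v₁, h₁⟩ := ih (fun l => emb (some (.inr l))) exit (fun l => hM (some (.inr l))) false
    refine ⟨v₁, ?_⟩
    rw [add_comm, Function.iterate_add_apply, ← h₁]
    refine congrArg _ ((first _ emb exit v _ hM).trans ((cond_eq _ _ hp).trans ?_))
    simp only [stk, hp]
    rfl
  | loop_true hp _ _ ih₁ ih₂ =>
    obtain ⟨v₁, h₁⟩ := ih₁ (fun l => emb (some l)) (emb none) (fun l => hM (some l)) true
    obtain ⟨v₂, h₂⟩ := ih₂ emb exit hM v₁
    refine ⟨v₂, ?_⟩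
    rw [add_comm, Function.iterate_add_apply, add_comm, Function.iterate_add_apply, ← h₂]
    refine congrArg _ (Eq.trans (congrArg _ ?_) h₁)
    refine (first _ emb exit v _ hM).trans ((cond_eq _ _ hp).trans ?_)
    simp only [stk, hp]
    rfl
  | loop_false hp =>
    refine ⟨false, (first _ emb exit v _ hM).trans ((cond_eq _ _ hp).trans ?_)⟩
    simp only [stk, hp]
    rfl
  | loopIn_true hp _ _ ih₁ ih₂ =>
    obtain ⟨v₁, h₁⟩ := ih₁ (fun l => emb (some l)) (emb none) (fun l => hM (some l)) true
    obtain ⟨v₂, h₂⟩ := ih₂ emb exit hM v₁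
    refine ⟨v₂, ?_⟩
    rw [add_comm, Function.iterate_add_apply, add_comm, Function.iterate_add_apply, ← h₂]
    refine congrArg _ (Eq.trans (congrArg _ ?_) h₁)
    refine (first _ emb exit v _ hM).trans ((cond_eq _ _ hp).trans ?_)
    simp only [stk, hp]
    rfl
  | loopIn_false hp =>
    refine ⟨false, (first _ emb exit v _ hM).trans ((cond_eq _ _ hp).trans ?_)⟩
    simp only [stk, hp]
    rfl

/-- The machine for a structured program, with the output on the stack `out`. -/
def machine [Fintype A] [Fintype K] (P : StackProg A K) (out : K) : Turing.FinTM2 where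
  K := Option K
  k₀ := none
  k₁ := some out
  Γ := Sym A K
  Λ := Option (Label P)
  main := some (entry P)
  σ := Bool
  initialState := false
  Γk₀Fin := inferInstanceAs (Fintype A)
  m
    | some l => code P some none l
    -- `Turing.haltList` demands the initial internal state, so the last test result is erased; this
    -- is the one extra step in the time bound.
    | none => Turing.TM2.Stmt.load (fun _ => false) Turing.TM2.Stmt.halt

theorem initList_machine [Fintype A] [Fintype K] (P : StackProg A K) (out : K) (w : List A) :
    Turing.initList (machine P out) w =
      ⟨some (some (entry P)), false, stk (w, fun _ => [])⟩ := by
  unfold Turing.initList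
  congr 1
  funext o
  rcases o with - | k
  · rfl
  · rfl

theorem haltList_machine [Fintype A] [Fintype K] (P : StackProg A K) (out : K) (w : List Bool) :
    Turing.haltList (machine P out) w =
      ⟨none, false, stk ([], Function.update (fun _ => []) out w)⟩ := by
  unfold Turing.haltList
  congr 1
  funext o
  rcases o with - | k
  · rfl
  · by_cases h : k = out
    · subst h
      refine (dif_pos rfl).trans ?_
      change w = Function.update (fun _ => []) k w k
      rw [Function.update_self]
    · refine (dif_neg (fun h' => h (Option.some.inj h'))).trans ?_
      change [] = Function.update (fun _ => []) out w k
      rw [Function.update_of_ne h]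

end StackProg

/-- A problem is solvable in polynomial time if a structured program decides it in polynomial
time. -/
theorem solvableInPolyTime_of_exec {α A K : Type} [Fintype A] [Fintype K] [DecidableEq K]
    {enc : α → List A} {p : α → Prop} (P : StackProg A K) (out : K) (T : Polynomial ℕ)
    (b : α → Bool) (hb : ∀ a, b a = true ↔ p a)
    (h : ∀ a, ∃ t ≤ T.eval (enc a).length,
      P.Exec (enc a, fun _ => []) ([], Function.update (fun _ => []) out [b a]) t) :
    SolvableInPolyTime enc p := by
  classical
  choose t ht hexec using h
  refine ⟨{
    tm := StackProg.machine P out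
    inputAlphabet := Equiv.refl A
    outputAlphabet := Equiv.refl Bool
    time := T + 1
    outputsFun := fun a => ⟨⟨t a + 1, ?_⟩, by simpa using ht a⟩ }⟩
  have hba : decide (p a) = b a := by rw [Bool.eq_iff_iff, hb]; simp
  have h₁ : List.map (Equiv.refl A).invFun (enc a) = enc a := List.map_id _
  have h₂ : List.map (Equiv.refl Bool).invFun (Computability.encodeBool (decide (p a))) = [b a] :=
    (List.map_id _).trans (congrArg (fun b => [b]) hba)
  obtain ⟨v, hv⟩ := (hexec a).iterate_step (StackProg.machine P out).m some none
    (fun _ => rfl) false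
  refine (congrArg (fun w => (flip bind (StackProg.machine P out).step)^[t a + 1]
    (some (Turing.initList (StackProg.machine P out) w))) h₁).trans ?_
  refine Eq.trans ?_ (congrArg (fun w => some (Turing.haltList (StackProg.machine P out) w)) h₂).symm
  rw [StackProg.initList_machine, StackProg.haltList_machine, add_comm, Function.iterate_add_apply]
  exact congrArg (flip bind (StackProg.machine P out).step)^[1] hv

namespace StackProg

variable {A K : Type} [DecidableEq K]

/-! ### Basic routines on stacks -/

/-- Empty a stack. -/
def clear (k : K) : StackProg A K := loop k Option.isSome (pop k)

/-- Move the height of a stack, in unary, to another stack. -/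
def transfer (k k' : K) : StackProg A K := loop k Option.isSome (seq (pop k) (push k' true))

/-- Move as many bits from the stack `y` to the stack `y'` as the height of `x` says, which is
moved to `x'`; missing bits are taken to be `false`. -/
def shift (x x' y y' : K) : StackProg A K :=
  loop x Option.isSome (seq (seq (pop x) (push x' true))
    (seq (ite y (fun o => o == some true) (push y' true) (push y' false)) (pop y)))

/-- Subtract the height of `x` from the height of `y`, with the removed parts kept on the stacks
`x'` and `y'`. -/
def subtract (x x' y y' : K) : StackProg A K :=
  loop x Option.isSome (seq (seq (pop x) (push x' true))
    (ite y Option.isSome (seq (pop y) (push y' true)) skip))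

theorem exec_clear (k : K) (S : Stacks A K) :
    Exec (clear k) S (S.1, Function.update S.2 k []) (2 * (S.2 k).length + 1) := by
  obtain ⟨w, F⟩ := S
  change Exec (clear k) (w, F) (w, Function.update F k []) (2 * (F k).length + 1)
  induction hl : F k generalizing F with
  | nil =>
    rw [show Function.update F k [] = F by rw [← hl, Function.update_eq_self]]
    exact Exec.loop_false (by simp [hl])
  | cons b l ih =>
    have h := ih (Function.update F k (F k).tail) (by simp [hl])
    rw [Function.update_idem] at h
    rw [show 2 * (b :: l).length + 1 = 1 + 1 + (2 * l.length + 1) by rw [List.length_cons]; ring]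
    exact Exec.loop_true (k := k) (p := Option.isSome) (by simp [hl]) (Exec.pop k (w, F)) h

theorem exec_transfer {k k' : K} (hk : k ≠ k') (S : Stacks A K) {n m : ℕ}
    (hn : S.2 k = List.replicate n true) (hm : S.2 k' = List.replicate m true) :
    ∃ S', Exec (transfer k k') S S' (3 * n + 1) ∧ S'.1 = S.1 ∧ S'.2 k = [] ∧
      S'.2 k' = List.replicate (n + m) true ∧ ∀ j, j ≠ k → j ≠ k' → S'.2 j = S.2 j := by
  induction n generalizing S m with
  | zero =>
    exact ⟨S, Exec.loop_false (by simp [hn]), rfl, by simp [hn], by simp [hm], fun _ _ _ => rfl⟩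
  | succ n ih =>
    obtain ⟨S₁, e, h1, h2⟩ : ∃ S₁, Exec (seq (pop k) (push k' true)) S S₁ 2 ∧ S₁.1 = S.1 ∧
        S₁.2 = Function.update (Function.update S.2 k (S.2 k).tail) k' (true :: S.2 k') :=
      ⟨_, (Exec.pop k S).seq (Exec.push k' true _), rfl, by simp [Function.update_of_ne hk.symm]⟩
    obtain ⟨S', h, k1, k2, k3, k4⟩ := ih S₁ (m := m + 1)
      (by simp [h2, hn, Function.update_of_ne hk, List.replicate_succ])
      (by simp [h2, hm, List.replicate_succ])
    refine ⟨S', ?_, k1.trans h1, k2, by rw [k3]; congr 1; omega, fun j hj hj' => ?_⟩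
    · rw [show 3 * (n + 1) + 1 = 1 + 2 + (3 * n + 1) by ring]
      exact Exec.loop_true (k := k) (p := Option.isSome) (by simp [hn, List.replicate_succ]) e h
    · rw [k4 j hj hj', h2, Function.update_of_ne hj', Function.update_of_ne hj]

theorem exec_move_bit {y y' : K} (S : Stacks A K) :
    ∃ S', Exec (ite y (fun o => o == some true) (push y' true) (push y' false)) S S' 2 ∧
      S'.1 = S.1 ∧ S'.2 = Function.update S.2 y' ((S.2 y).getD 0 false :: S.2 y') := by
  rcases hy : S.2 y with - | ⟨b, l⟩
  · exact ⟨_, Exec.ite_false (by simp [hy]) (Exec.push y' false S), rfl, by simp⟩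
  · cases b
    · exact ⟨_, Exec.ite_false (by simp [hy]) (Exec.push y' false S), rfl, by simp⟩
    · exact ⟨_, Exec.ite_true (by simp [hy]) (Exec.push y' true S), rfl, by simp⟩

/-- This gives random access: the entry at position `n` comes to the top of `y`. The prefix is
stored reversed on `y'`, with `false` for entries below the bottom of the stack, and a second shift
in the opposite direction restores it. -/
theorem exec_shift {x x' y y' : K} (h₁ : x ≠ x') (h₂ : x ≠ y) (h₃ : x ≠ y') (h₄ : x' ≠ y)
    (h₅ : x' ≠ y') (h₆ : y ≠ y') (S : Stacks A K) {n m : ℕ}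
    (hn : S.2 x = List.replicate n true) (hm : S.2 x' = List.replicate m true) :
    ∃ S', Exec (shift x x' y y') S S' (6 * n + 1) ∧ S'.1 = S.1 ∧ S'.2 x = [] ∧
      S'.2 x' = List.replicate (n + m) true ∧ S'.2 y = (S.2 y).drop n ∧
      S'.2 y' = ((List.range n).map fun i => (S.2 y).getD i false).reverse ++ S.2 y' ∧
      ∀ j, j ≠ x → j ≠ x' → j ≠ y → j ≠ y' → S'.2 j = S.2 j := by
  induction n generalizing S m with
  | zero =>
    exact ⟨S, Exec.loop_false (by simp [hn]), rfl, by simp [hn], by simp [hm], by simp, by simp,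
      fun _ _ _ _ _ => rfl⟩
  | succ n ih =>
    obtain ⟨S₁, e, k1, k2⟩ : ∃ S₁, Exec (seq (pop x) (push x' true)) S S₁ 2 ∧ S₁.1 = S.1 ∧
        S₁.2 = Function.update (Function.update S.2 x (S.2 x).tail) x' (true :: S.2 x') :=
      ⟨_, (Exec.pop x S).seq (Exec.push x' true _), rfl, by simp [Function.update_of_ne h₁.symm]⟩
    obtain ⟨S₂, e₂, k3, k4⟩ := exec_move_bit (y := y) (y' := y') S₁
    obtain ⟨S₃, e₃, k5, k6⟩ : ∃ S₃, Exec (pop y) S₂ S₃ 1 ∧ S₃.1 = S₂.1 ∧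
        S₃.2 = Function.update S₂.2 y (S₂.2 y).tail := ⟨_, Exec.pop y S₂, rfl, rfl⟩
    have hx : S₃.2 x = List.replicate n true := by
      simp [k6, k4, k2, hn, Function.update_of_ne h₁, Function.update_of_ne h₂,
        Function.update_of_ne h₃, List.replicate_succ]
    have hx' : S₃.2 x' = List.replicate (m + 1) true := by
      simp [k6, k4, k2, hm, Function.update_of_ne h₄, Function.update_of_ne h₅,
        List.replicate_succ]
    have hy : S₃.2 y = (S.2 y).tail := by
      simp [k6, k4, k2, Function.update_of_ne h₆, Function.update_of_ne h₂.symm,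
        Function.update_of_ne h₄.symm]
    have hy' : S₃.2 y' = (S.2 y).getD 0 false :: S.2 y' := by
      simp [k6, k4, k2, Function.update_of_ne h₆.symm, Function.update_of_ne h₂.symm,
        Function.update_of_ne h₄.symm, Function.update_of_ne h₃.symm, Function.update_of_ne h₅.symm]
    obtain ⟨S', h, l1, l2, l3, l4, l5, l6⟩ := ih S₃ hx hx'
    refine ⟨S', ?_, by rw [l1, k5, k3, k1], l2, by rw [l3]; congr 1; omega, ?_, ?_,
      fun j j₁ j₂ j₃ j₄ => ?_⟩
    · rw [show 6 * (n + 1) + 1 = 1 + (2 + (2 + 1)) + (6 * n + 1) by ring]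
      exact Exec.loop_true (k := x) (p := Option.isSome) (by simp [hn, List.replicate_succ])
        (e.seq (e₂.seq e₃)) h
    · rw [l4, hy, List.drop_tail]
    · rw [l5, hy', hy, List.range_succ_eq_map, List.map_cons, List.map_map, List.reverse_cons,
        List.append_assoc, List.singleton_append]
      congr 3
      funext i
      simp [Function.comp]
    · rw [l6 j j₁ j₂ j₃ j₄, k6, Function.update_of_ne j₃, k4, Function.update_of_ne j₄, k2,
        Function.update_of_ne j₂, Function.update_of_ne j₁]

/-- A comparison of unary numbers that can be undone: `y` stays nonempty exactly if `n < p`, and the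
removed parts are still available on `x'` and `y'`. -/
theorem exec_subtract {x x' y y' : K} (h₁ : x ≠ x') (h₂ : x ≠ y) (h₃ : x ≠ y') (h₄ : x' ≠ y)
    (h₅ : x' ≠ y') (h₆ : y ≠ y') (S : Stacks A K) {n m p q : ℕ}
    (hn : S.2 x = List.replicate n true) (hm : S.2 x' = List.replicate m true)
    (hp : S.2 y = List.replicate p true) (hq : S.2 y' = List.replicate q true) :
    ∃ S' t, Exec (subtract x x' y y') S S' t ∧ t ≤ 6 * n + 1 ∧ S'.1 = S.1 ∧ S'.2 x = [] ∧
      S'.2 x' = List.replicate (n + m) true ∧ S'.2 y = List.replicate (p - n) true ∧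
      S'.2 y' = List.replicate (q + min p n) true ∧
      ∀ j, j ≠ x → j ≠ x' → j ≠ y → j ≠ y' → S'.2 j = S.2 j := by
  induction n generalizing S m p q with
  | zero =>
    exact ⟨S, 1, Exec.loop_false (by simp [hn]), by simp, rfl, by simp [hn], by simp [hm],
      by simp [hp], by simp [hq], fun _ _ _ _ _ => rfl⟩
  | succ n ih =>
    obtain ⟨S₁, e, k1, k2⟩ : ∃ S₁, Exec (seq (pop x) (push x' true)) S S₁ 2 ∧ S₁.1 = S.1 ∧
        S₁.2 = Function.update (Function.update S.2 x (S.2 x).tail) x' (true :: S.2 x') :=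
      ⟨_, (Exec.pop x S).seq (Exec.push x' true _), rfl, by simp [Function.update_of_ne h₁.symm]⟩
    obtain ⟨S₂, t₂, e₂, ht₂, k3, hy, hy', hj⟩ : ∃ S₂ t, Exec (ite y Option.isSome
        (seq (pop y) (push y' true)) skip) S₁ S₂ t ∧ t ≤ 3 ∧ S₂.1 = S₁.1 ∧
        S₂.2 y = List.replicate (p - 1) true ∧ S₂.2 y' = List.replicate (q + min p 1) true ∧
        ∀ j, j ≠ y → j ≠ y' → S₂.2 j = S₁.2 j := by
      have hy : S₁.2 y = List.replicate p true := by
        rw [k2, Function.update_of_ne h₄.symm, Function.update_of_ne h₂.symm, hp]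
      have hy' : S₁.2 y' = List.replicate q true := by
        rw [k2, Function.update_of_ne h₅.symm, Function.update_of_ne h₃.symm, hq]
      rcases p with - | p
      · exact ⟨_, _, Exec.ite_false (by simp [hy]) (Exec.skip S₁), by omega, rfl, by simp [hy],
          by simp [hy'], fun _ _ _ => rfl⟩
      · refine ⟨_, _, Exec.ite_true (by simp [hy, List.replicate_succ])
          ((Exec.pop y S₁).seq (Exec.push y' true _)), by omega, rfl,
          by simp [hy, Function.update_of_ne h₆, List.replicate_succ], ?_, fun j j₁ j₂ => ?_⟩
        · simp [hy', Function.update_of_ne h₆.symm, List.replicate_succ]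
        · simp [Function.update_of_ne j₁, Function.update_of_ne j₂]
    obtain ⟨S', t, h, ht, l1, l2, l3, l4, l5, l6⟩ := ih S₂ (m := m + 1)
      (by rw [hj x h₂ h₃]; simp [k2, hn, Function.update_of_ne h₁, List.replicate_succ])
      (by rw [hj x' h₄ h₅]; simp [k2, hm, List.replicate_succ]) hy hy'
    refine ⟨S', _, Exec.loop_true (k := x) (p := Option.isSome)
      (by simp [hn, List.replicate_succ]) (e.seq e₂) h, by omega, by rw [l1, k3, k1], l2,
      by rw [l3]; congr 1; omega, by rw [l4]; congr 1; omega, by rw [l5]; congr 1; omega,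
      fun j j₁ j₂ j₃ j₄ => ?_⟩
    rw [l6 j j₁ j₂ j₃ j₄, hj j j₃ j₄, k2, Function.update_of_ne j₂, Function.update_of_ne j₁]

end StackProg

/-! ### Loop programs -/

/-- The states of loop programs: counters and (infinite) arrays of bits. -/
structure LoopState (X Y : Type) : Type where
  /-- the values of the counters -/
  ctr : X → ℕ
  /-- the contents of the arrays -/
  arr : Y → ℕ → Bool

/-- Loop programs, with read-only registers `C`, counters `X` and arrays `Y`. A loop is executed as
often as the value of a read-only register says. -/
inductive LoopProg (C X Y : Type) : Type
  | inc (x : X)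
  | clear (x : X)
  | iflt (x x' : X) (P Q : LoopProg C X Y)
  | ifbit (y : Y) (x : X) (P Q : LoopProg C X Y)
  | setbit (y : Y) (x : X)
  | skip
  | seq (P Q : LoopProg C X Y)
  | loop (c : C) (P : LoopProg C X Y)

/-- The stacks that a machine for loop programs needs. -/
inductive Reg (C X Y : Type) : Type
  | out
  | ctl
  | tmp₁
  | tmp₂
  | cst (c : C)
  | ctr (x : X)
  | arr (y : Y)
  deriving DecidableEq, Fintype

namespace LoopProg

variable {A C X Y : Type} [DecidableEq C] [DecidableEq X] [DecidableEq Y]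

/-- The state after a loop program. -/
def eval (N : C → ℕ) : LoopProg C X Y → LoopState X Y → LoopState X Y
  | inc x, s => { s with ctr := Function.update s.ctr x (s.ctr x + 1) }
  | clear x, s => { s with ctr := Function.update s.ctr x 0 }
  | iflt x x' P Q, s => if s.ctr x < s.ctr x' then eval N P s else eval N Q s
  | ifbit y x P Q, s => if s.arr y (s.ctr x) = true then eval N P s else eval N Q s
  | setbit y x, s =>
    { s with arr := Function.update s.arr y (Function.update (s.arr y) (s.ctr x) true) }
  | skip, s => s
  | seq P Q, s => eval N Q (eval N P s)
  | loop c P, s => (eval N P)^[N c] s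

open Reg in
/-- The translation of loop programs to programs on stacks. -/
def compile : LoopProg C X Y → StackProg A (Reg C X Y)
  | inc x => .push (ctr x) true
  | clear x => .clear (ctr x)
  -- Subtraction needs distinct stacks; for `x = x'` the test is false anyway. Both branches first
  -- restore the counters.
  | iflt x x' P Q => if x = x' then compile Q else
    .seq (.subtract (ctr x) tmp₁ (ctr x') tmp₂)
      (.ite (ctr x') Option.isSome
        (.seq (.seq (.transfer tmp₁ (ctr x)) (.transfer tmp₂ (ctr x'))) (compile P))
        (.seq (.seq (.transfer tmp₁ (ctr x)) (.transfer tmp₂ (ctr x'))) (compile Q)))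
  | ifbit y x P Q => .seq (.shift (ctr x) tmp₂ (arr y) tmp₁)
      (.ite (arr y) (fun o => o == some true)
        (.seq (.shift tmp₂ (ctr x) tmp₁ (arr y)) (compile P))
        (.seq (.shift tmp₂ (ctr x) tmp₁ (arr y)) (compile Q)))
  | setbit y x => .seq (.shift (ctr x) tmp₂ (arr y) tmp₁)
      (.seq (.seq (.pop (arr y)) (.push (arr y) true)) (.shift tmp₂ (ctr x) tmp₁ (arr y)))
  | skip => .skip
  | seq P Q => .seq (compile P) (compile Q)
  -- The number of iterations is copied to `ctl` above a marker `false`, so nested loops can share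
  -- this stack. The detour through `tmp₁` is needed because reading a unary stack empties it.
  | loop c P => .seq (.seq (.push ctl false) (.transfer (cst c) tmp₁))
      (.seq (.loop tmp₁ Option.isSome
          (.seq (.pop tmp₁) (.seq (.push (cst c) true) (.push ctl true))))
        (.seq (.loop ctl (fun o => o == some true) (.seq (.pop ctl) (compile P))) (.pop ctl)))

/-- A polynomial which, in terms of a bound for the values of the read-only registers, bounds the
number of basic steps of a loop program. -/
noncomputable def weight : LoopProg C X Y → Polynomial ℕ
  | inc _ => 1
  | clear _ => 2
  | iflt _ _ P Q => weight P + weight Q + 12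
  | ifbit _ _ P Q => weight P + weight Q + 12
  | setbit _ _ => 12
  | skip => 1
  | seq P Q => weight P + weight Q
  | loop _ P => Polynomial.X * weight P + 9

/-- The stacks `F` represent the state `s` of a loop program, with values `N` of the read-only
registers and contents `L` of the stack that controls the loops. -/
structure Rep (N : C → ℕ) (L : List Bool) (F : Reg C X Y → List Bool) (s : LoopState X Y) :
    Prop where
  out : F .out = []
  ctl : F .ctl = L
  tmp₁ : F .tmp₁ = []
  tmp₂ : F .tmp₂ = []
  cst (c : C) : F (.cst c) = List.replicate (N c) true
  ctr (x : X) : F (.ctr x) = List.replicate (s.ctr x) true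
  arr (y : Y) (i : ℕ) : (F (.arr y)).getD i false = s.arr y i

/-! ### Correctness and running time of compiled loop programs -/

variable {N : C → ℕ} {L : List Bool}

theorem exec_ifbit_shift {F : Reg C X Y → List Bool} {s : LoopState X Y} (h : Rep N L F s)
    (w : List A) (y : Y) (x : X) : ∃ S', StackProg.Exec (.shift (.ctr x) .tmp₂ (.arr y) .tmp₁) (w, F) S'
      (6 * s.ctr x + 1) ∧ S'.1 = w ∧ S'.2 (.ctr x) = [] ∧
      S'.2 .tmp₂ = List.replicate (s.ctr x) true ∧ S'.2 (.arr y) = (F (.arr y)).drop (s.ctr x) ∧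
      S'.2 .tmp₁ = ((List.range (s.ctr x)).map (s.arr y)).reverse ∧
      ∀ j, j ≠ .ctr x → j ≠ .tmp₂ → j ≠ .arr y → j ≠ .tmp₁ → S'.2 j = F j := by
  obtain ⟨S', e, h1, h2, h3, h4, h5, h6⟩ := StackProg.exec_shift (x := .ctr x) (x' := .tmp₂)
    (y := .arr y) (y' := .tmp₁) (by simp) (by simp) (by simp) (by simp) (by simp) (by simp)
    (w, F) (h.ctr x) (m := 0) h.tmp₂
  refine ⟨S', e, h1, h2, h3, h4, ?_, h6⟩
  rw [h5, show (w, F).2 .tmp₁ = [] from h.tmp₁, List.append_nil]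
  congr 3
  funext i
  exact h.arr y i

/-- The second reversal restores the prefix. The array stack may become longer by padding with
`false`, which does not change the infinite array it represents. -/
theorem exec_unshift (S : Stacks A (Reg C X Y)) (y : Y) (x : X) {n : ℕ} {a : ℕ → Bool}
    (h₁ : S.2 (.ctr x) = []) (h₂ : S.2 .tmp₂ = List.replicate n true)
    (h₃ : S.2 .tmp₁ = ((List.range n).map a).reverse) :
    ∃ S', StackProg.Exec (.shift .tmp₂ (.ctr x) .tmp₁ (.arr y)) S S' (6 * n + 1) ∧ S'.1 = S.1 ∧
      S'.2 (.ctr x) = List.replicate n true ∧ S'.2 .tmp₂ = [] ∧ S'.2 .tmp₁ = [] ∧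
      S'.2 (.arr y) = (List.range n).map a ++ S.2 (.arr y) ∧
      ∀ j, j ≠ .ctr x → j ≠ .tmp₂ → j ≠ .arr y → j ≠ .tmp₁ → S'.2 j = S.2 j := by
  obtain ⟨S', e, k1, k2, k3, k4, k5, k6⟩ := StackProg.exec_shift (x := .tmp₂) (x' := .ctr x)
    (y := .tmp₁) (y' := .arr y) (by simp) (by simp) (by simp) (by simp) (by simp) (by simp)
    S h₂ (m := 0) h₁
  refine ⟨S', e, k1, k3, k2, ?_, ?_, fun j j₁ j₂ j₃ j₄ => k6 j j₂ j₁ j₄ j₃⟩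
  · rw [k4, h₃]
    exact List.drop_of_length_le (by simp)
  · rw [k5, h₃]
    congr 1
    rw [List.reverse_eq_iff]
    refine List.ext_getElem (by simp) fun i hi hi' => ?_
    rw [List.getElem_map, List.getElem_range, List.getD_eq_getElem]

/-- `S'` is the moment between subtraction and restoration, when the branch is decided; the
restoration leads back to exactly `(w, F)`. -/
theorem exec_compare {F : Reg C X Y → List Bool} {s : LoopState X Y} (h : Rep N L F s)
    (w : List A) {x x' : X} (hx : x ≠ x') : ∃ S' t t',
      StackProg.Exec (.subtract (.ctr x) .tmp₁ (.ctr x') .tmp₂) (w, F) S' t ∧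
      StackProg.Exec (.seq (.transfer .tmp₁ (.ctr x)) (.transfer .tmp₂ (.ctr x'))) S' (w, F) t' ∧
      t + t' ≤ 9 * s.ctr x + 3 * s.ctr x' + 3 ∧
      (S'.2 (.ctr x')).head?.isSome = decide (s.ctr x < s.ctr x') := by
  obtain ⟨S₁, t, e, ht, h1, h2, h3, h4, h5, h6⟩ := StackProg.exec_subtract (x := .ctr x)
    (x' := .tmp₁) (y := .ctr x') (y' := .tmp₂) (by simp) (by simpa using hx) (by simp) (by simp)
    (by simp) (by simp) (w, F) (h.ctr x) (m := 0) h.tmp₁ (h.ctr x') (q := 0) h.tmp₂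
  obtain ⟨S₂, e₂, k1, k2, k3, k4⟩ := StackProg.exec_transfer (k := .tmp₁) (k' := .ctr x) (by simp)
    S₁ h3 (m := 0) h2
  obtain ⟨S₃, e₃, l1, l2, l3, l4⟩ := StackProg.exec_transfer (k := .tmp₂) (k' := .ctr x') (by simp)
    S₂ ((k4 _ (by simp) (by simp)).trans h5)
    ((k4 (.ctr x') (by simp) (by simpa using hx.symm)).trans h4)
  have hS₃ : S₃ = (w, F) := by
    refine Prod.ext (by rw [l1, k1, h1]) (funext fun j => ?_)
    by_cases j₂ : j = .tmp₂
    · rw [j₂, l2]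
      exact h.tmp₂.symm
    by_cases j₃ : j = .ctr x'
    · rw [j₃, l3]
      refine Eq.trans ?_ (h.ctr x').symm
      congr 1
      omega
    rw [l4 j j₂ j₃]
    by_cases j₁ : j = .tmp₁
    · rw [j₁, k2]
      exact h.tmp₁.symm
    by_cases j₄ : j = .ctr x
    · rw [j₄, k3]
      exact (h.ctr x).symm
    rw [k4 j j₁ j₄, h6 j j₄ j₁ j₃ j₂]
  subst hS₃
  refine ⟨S₁, _, _, e, e₂.seq e₃, by omega, ?_⟩
  rw [h4]
  rcases hd : s.ctr x' - s.ctr x with - | d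
  · simp
    omega
  · simp [List.replicate_succ]
    omega

theorem exec_loop_count (c : C) (S : Stacks A (Reg C X Y)) {n m : ℕ} {L : List Bool}
    (h₁ : S.2 .tmp₁ = List.replicate n true) (h₂ : S.2 (.cst c) = List.replicate m true)
    (h₃ : S.2 .ctl = L) :
    ∃ S', StackProg.Exec (.loop .tmp₁ Option.isSome
        (.seq (.pop .tmp₁) (.seq (.push (.cst c) true) (.push .ctl true)))) S S' (4 * n + 1) ∧
      S'.1 = S.1 ∧ S'.2 .tmp₁ = [] ∧ S'.2 (.cst c) = List.replicate (n + m) true ∧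
      S'.2 .ctl = List.replicate n true ++ L ∧
      ∀ j, j ≠ .tmp₁ → j ≠ .cst c → j ≠ .ctl → S'.2 j = S.2 j := by
  induction n generalizing S m L with
  | zero =>
    exact ⟨S, .loop_false (by simp [h₁]), rfl, by simp [h₁], by simp [h₂], by simp [h₃],
      fun _ _ _ _ => rfl⟩
  | succ n ih =>
    obtain ⟨S₁, e, k1, k2⟩ : ∃ S₁, StackProg.Exec
        (.seq (.pop .tmp₁) (.seq (.push (.cst c) true) (.push .ctl true))) S S₁ 3 ∧ S₁.1 = S.1 ∧
        S₁.2 = Function.update (Function.update (Function.update S.2 .tmp₁ (S.2 .tmp₁).tail)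
          (.cst c) (true :: S.2 (.cst c))) .ctl (true :: S.2 .ctl) := by
      refine ⟨_, (StackProg.Exec.pop .tmp₁ S).seq ((StackProg.Exec.push (.cst c) true _).seq
        (StackProg.Exec.push .ctl true _)), ?_, ?_⟩
      · rfl
      · simp
    obtain ⟨S', h, l1, l2, l3, l4, l5⟩ := ih S₁ (m := m + 1) (L := true :: L)
      (by simp [k2, h₁, List.replicate_succ]) (by simp [k2, h₂, List.replicate_succ])
      (by simp [k2, h₃])
    refine ⟨S', ?_, by rw [l1, k1], l2, by rw [l3]; congr 1; omega, ?_, fun j j₁ j₂ j₃ => ?_⟩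
    · rw [show 4 * (n + 1) + 1 = 1 + 3 + (4 * n + 1) by ring]
      exact .loop_true (by simp [h₁, List.replicate_succ]) e h
    · rw [l4, List.replicate_succ', List.append_assoc, List.singleton_append]
    · rw [l5 j j₁ j₂ j₃, k2, Function.update_of_ne j₃, Function.update_of_ne j₂,
        Function.update_of_ne j₁]

/-- The weight bounds two quantities at once: the growth of the stacks, and the running time in
units of `B' + 1`. Here `B` bounds the heights at the start, while `B'` dominates the heights
reached within the whole run and stays fixed in the induction. The stack `ctl` is exempt from the
height bound, since it is only pushed, popped and inspected at its top, at a cost independent of its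
height. -/
theorem exec_compile (P : LoopProg C X Y) (L : List Bool) (F : Reg C X Y → List Bool)
    (s : LoopState X Y) (M B B' : ℕ) (w : List A) (hF : Rep N L F s) (hM : ∀ c, N c ≤ M)
    (hB : ∀ k, k ≠ .ctl → (F k).length ≤ B) (hB' : B + P.weight.eval M ≤ B') :
    ∃ F' t, P.compile.Exec (w, F) (w, F') t ∧ Rep N L F' (P.eval N s) ∧
      (∀ k, k ≠ .ctl → (F' k).length ≤ B + P.weight.eval M) ∧
      t ≤ P.weight.eval M * (B' + 1) := by
  induction P generalizing L F s B with
  | inc x =>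
    simp only [weight, Polynomial.eval_one] at hB' ⊢
    refine ⟨_, _, StackProg.Exec.push _ _ _, ⟨?_, ?_, ?_, ?_, ?_, ?_, ?_⟩, ?_, ?_⟩
    · simp [hF.out]
    · simp [hF.ctl]
    · simp [hF.tmp₁]
    · simp [hF.tmp₂]
    · simp [hF.cst]
    · intro x'
      by_cases h : x' = x
      · subst h
        simp [hF.ctr, eval, List.replicate_succ]
      · simp [hF.ctr, eval, h]
    · intro y i
      simpa [eval] using hF.arr y i
    · intro k hk
      by_cases h : k = .ctr x
      · subst h
        simpa using hB _ hk
      · simpa [h] using (hB _ hk).trans (Nat.le_succ _)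
    · omega
  | clear x =>
    simp only [weight, Polynomial.eval_ofNat] at hB' ⊢
    refine ⟨_, _, StackProg.exec_clear _ _, ⟨?_, ?_, ?_, ?_, ?_, ?_, ?_⟩, ?_, ?_⟩
    · simp [hF.out]
    · simp [hF.ctl]
    · simp [hF.tmp₁]
    · simp [hF.tmp₂]
    · simp [hF.cst]
    · intro x'
      by_cases h : x' = x
      · subst h
        simp [eval]
      · simp [hF.ctr, eval, h]
    · intro y i
      simpa [eval] using hF.arr y i
    · intro k hk
      by_cases h : k = .ctr x
      · subst h
        simp
      · simpa [h] using (hB _ hk).trans (Nat.le_add_right _ 2)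
    · have := hB (.ctr x) (by simp)
      dsimp only
      omega
  | skip =>
    simp only [weight, Polynomial.eval_one] at hB' ⊢
    exact ⟨_, _, StackProg.Exec.skip _, hF, fun k hk => (hB k hk).trans (Nat.le_succ _), by omega⟩
  | seq P Q ihP ihQ =>
    simp only [weight, Polynomial.eval_add] at hB' ⊢
    obtain ⟨F₁, t₁, e₁, r₁, b₁, c₁⟩ := ihP L F s B hF hB (by omega)
    obtain ⟨F₂, t₂, e₂, r₂, b₂, c₂⟩ := ihQ L F₁ _ (B + P.weight.eval M) r₁ b₁ (by omega)
    refine ⟨F₂, _, e₁.seq e₂, r₂, fun k hk => by have := b₂ k hk; omega, ?_⟩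
    rw [add_mul]
    omega
  | iflt x x' P Q ihP ihQ =>
    simp only [weight, Polynomial.eval_add, Polynomial.eval_ofNat] at hB' ⊢
    by_cases hx : x = x'
    · obtain ⟨F', t, e, r, b, c⟩ := ihQ L F s B hF hB (by omega)
      refine ⟨F', t, by simpa [compile, hx] using e, by simpa [eval, hx] using r,
        fun k hk => (b k hk).trans (by omega), c.trans (Nat.mul_le_mul_right _ (by omega))⟩
    · obtain ⟨S₁, t₁, t₂, e₁, e₂, ht, hd⟩ := exec_compare hF w hx
      have hbx := hB (.ctr x) (by simp)
      have hbx' := hB (.ctr x') (by simp)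
      rw [hF.ctr, List.length_replicate] at hbx hbx'
      simp only [compile, if_neg hx, eval]
      by_cases hlt : s.ctr x < s.ctr x'
      · obtain ⟨F', t, e, r, b, c⟩ := ihP L F s B hF hB (by omega)
        rw [if_pos hlt]
        refine ⟨F', _, e₁.seq (.ite_true (by rw [hd]; simpa using hlt) (e₂.seq e)), r,
          fun k hk => (b k hk).trans (by omega), ?_⟩
        rw [add_mul, add_mul]
        have := Nat.zero_le (Polynomial.eval M Q.weight * (B' + 1))
        omega
      · obtain ⟨F', t, e, r, b, c⟩ := ihQ L F s B hF hB (by omega)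
        rw [if_neg hlt]
        refine ⟨F', _, e₁.seq (.ite_false (by rw [hd]; simpa using hlt) (e₂.seq e)), r,
          fun k hk => (b k hk).trans (by omega), ?_⟩
        rw [add_mul, add_mul]
        have := Nat.zero_le (Polynomial.eval M P.weight * (B' + 1))
        omega
  | ifbit y x P Q ihP ihQ =>
    simp only [weight, Polynomial.eval_add, Polynomial.eval_ofNat] at hB' ⊢
    have hbx := hB (.ctr x) (by simp)
    rw [hF.ctr, List.length_replicate] at hbx
    obtain ⟨S₁, e₁, h1, h2, h3, h4, h5, h6⟩ := exec_ifbit_shift hF w y x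
    obtain ⟨⟨w₂, F₂⟩, e₂, k1, k2, k3, k4, k5, k6⟩ := exec_unshift S₁ y x h2 h3 h5
    obtain rfl : w₂ = w := k1.trans h1
    have hj : ∀ j, j ≠ .ctr x → j ≠ .tmp₂ → j ≠ .arr y → j ≠ .tmp₁ → F₂ j = F j :=
      fun j j₁ j₂ j₃ j₄ => (k6 j j₁ j₂ j₃ j₄).trans (h6 j j₁ j₂ j₃ j₄)
    have hF₂ : Rep N L F₂ s := by
      refine ⟨?_, ?_, k4, k3, fun c => ?_, fun x' => ?_, fun y' i => ?_⟩
      · rw [hj _ (by simp) (by simp) (by simp) (by simp), hF.out]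
      · rw [hj _ (by simp) (by simp) (by simp) (by simp), hF.ctl]
      · rw [hj _ (by simp) (by simp) (by simp) (by simp), hF.cst]
      · by_cases hx : x' = x
        · rw [hx]
          exact k2
        · rw [hj _ (by simpa using hx) (by simp) (by simp) (by simp), hF.ctr]
      · by_cases hy : y' = y
        · subst hy
          change F₂ (.arr y') = _ at k5
          rw [k5, h4]
          by_cases hi : i < s.ctr x
          · rw [List.getD_append _ _ _ _ (by simpa using hi), List.getD_eq_getElem _ _ (by simpa)]
            simp
          · rw [List.getD_append_right _ _ _ _ (by simpa using hi), ← hF.arr]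
            simp [show s.ctr x + (i - s.ctr x) = i by omega]
        · rw [hj _ (by simp) (by simp) (by simpa using hy) (by simp), hF.arr]
    have hB₂ : ∀ k, k ≠ .ctl → (F₂ k).length ≤ B := by
      intro k hk
      by_cases j₁ : k = .ctr x
      · rw [j₁, hF₂.ctr]
        simpa using hbx
      by_cases j₂ : k = .tmp₂
      · simp [j₂, hF₂.tmp₂]
      by_cases j₄ : k = .tmp₁
      · simp [j₄, hF₂.tmp₁]
      by_cases j₃ : k = .arr y
      · subst j₃
        have := hB _ hk
        change F₂ (.arr y) = _ at k5
        rw [k5, h4]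
        simp
        omega
      · rw [hj k j₁ j₂ j₃ j₄]
        exact hB k hk
    -- An exhausted stack has no top and counts as `false`, in agreement with the default value of
    -- the array.
    have hd : ((S₁.2 (.arr y)).head? == some true) = s.arr y (s.ctr x) := by
      rw [h4, ← hF.arr, List.head?_drop, List.getD_eq_getElem?_getD]
      rcases (F (.arr y))[s.ctr x]? with - | b
      · rfl
      · cases b <;> rfl
    simp only [compile, eval]
    by_cases hb : s.arr y (s.ctr x) = true
    · obtain ⟨F', t, e, r, b, c⟩ := ihP L F₂ s B hF₂ hB₂ (by omega)
      rw [if_pos hb]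
      refine ⟨F', _, e₁.seq (.ite_true (by rw [hd, hb]) (e₂.seq e)), r,
        fun k hk => (b k hk).trans (by omega), ?_⟩
      rw [add_mul, add_mul]
      have := Nat.zero_le (Polynomial.eval M Q.weight * (B' + 1))
      omega
    · obtain ⟨F', t, e, r, b, c⟩ := ihQ L F₂ s B hF₂ hB₂ (by omega)
      rw [if_neg hb]
      refine ⟨F', _, e₁.seq (.ite_false (by rw [hd]; simpa using hb) (e₂.seq e)), r,
        fun k hk => (b k hk).trans (by omega), ?_⟩
      rw [add_mul, add_mul]
      have := Nat.zero_le (Polynomial.eval M P.weight * (B' + 1))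
      omega
  | setbit y x =>
    simp only [weight, Polynomial.eval_ofNat] at hB' ⊢
    have hbx := hB (.ctr x) (by simp)
    rw [hF.ctr, List.length_replicate] at hbx
    obtain ⟨S₁, e₁, h1, h2, h3, h4, h5, h6⟩ := exec_ifbit_shift hF w y x
    obtain ⟨S₂, e₂, l1, l2⟩ : ∃ S₂, StackProg.Exec (.seq (.pop (.arr y)) (.push (.arr y) true))
        S₁ S₂ 2 ∧ S₂.1 = S₁.1 ∧
        S₂.2 = Function.update S₁.2 (.arr y) (true :: (F (.arr y)).drop (s.ctr x + 1)) := by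
      refine ⟨_, (StackProg.Exec.pop _ S₁).seq (StackProg.Exec.push _ true _), rfl, ?_⟩
      simp [h4]
    obtain ⟨⟨w₂, F₂⟩, e₃, k1, k2, k3, k4, k5, k6⟩ := exec_unshift S₂ y x
      (by rw [l2]; simpa using h2) (by rw [l2]; simpa using h3) (by rw [l2]; simpa using h5)
    obtain rfl : w₂ = w := (k1.trans l1).trans h1
    have hj : ∀ j, j ≠ .ctr x → j ≠ .tmp₂ → j ≠ .arr y → j ≠ .tmp₁ → F₂ j = F j := by
      intro j j₁ j₂ j₃ j₄
      rw [← h6 j j₁ j₂ j₃ j₄]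
      exact (k6 j j₁ j₂ j₃ j₄).trans (by rw [l2, Function.update_of_ne j₃])
    change F₂ (.arr y) = _ at k5
    rw [l2, Function.update_self] at k5
    have hF₂ : Rep N L F₂ ((setbit y x).eval N s) := by
      refine ⟨?_, ?_, k4, k3, fun c => ?_, fun x' => ?_, fun y' i => ?_⟩
      · rw [hj _ (by simp) (by simp) (by simp) (by simp), hF.out]
      · rw [hj _ (by simp) (by simp) (by simp) (by simp), hF.ctl]
      · rw [hj _ (by simp) (by simp) (by simp) (by simp), hF.cst]
      · by_cases hx : x' = x
        · rw [hx]
          exact k2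
        · rw [hj _ (by simpa using hx) (by simp) (by simp) (by simp), hF.ctr]
          rfl
      · by_cases hy : y' = y
        · subst hy
          rw [k5]
          simp only [eval, Function.update_self]
          rcases lt_trichotomy i (s.ctr x) with hi | hi | hi
          · rw [List.getD_append _ _ _ _ (by simpa using hi), List.getD_eq_getElem _ _ (by simpa),
              Function.update_of_ne hi.ne]
            simp
          · rw [List.getD_append_right _ _ _ _ (by simp [hi]), hi, Function.update_self]
            simp
          · rw [List.getD_append_right _ _ _ _ (by simpa using hi.le),
              Function.update_of_ne hi.ne', ← hF.arr]
            obtain ⟨d, rfl⟩ := Nat.exists_eq_add_of_lt hi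
            rw [List.length_map, List.length_range, show s.ctr x + d + 1 - s.ctr x = d + 1 by omega,
              List.getD_cons_succ, List.getD_eq_getElem?_getD, List.getElem?_drop,
              ← List.getD_eq_getElem?_getD, show s.ctr x + 1 + d = s.ctr x + d + 1 by omega]
        · rw [hj _ (by simp) (by simp) (by simpa using hy) (by simp), hF.arr]
          simp [eval, hy]
    refine ⟨F₂, _, e₁.seq (e₂.seq e₃), hF₂, fun k hk => ?_, by omega⟩
    by_cases j₁ : k = .ctr x
    · rw [j₁, hF₂.ctr]
      simpa [eval] using hbx.trans (Nat.le_add_right _ _)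
    by_cases j₂ : k = .tmp₂
    · simp [j₂, hF₂.tmp₂]
    by_cases j₄ : k = .tmp₁
    · simp [j₄, hF₂.tmp₁]
    by_cases j₃ : k = .arr y
    · subst j₃
      have := hB _ hk
      rw [k5]
      simp
      omega
    · rw [hj k j₁ j₂ j₃ j₄]
      exact (hB k hk).trans (Nat.le_add_right _ _)
  | loop c P ih =>
    simp only [weight, Polynomial.eval_add, Polynomial.eval_mul, Polynomial.eval_X,
      Polynomial.eval_ofNat] at hB' ⊢
    have hbc := hB (.cst c) (by simp)
    rw [hF.cst, List.length_replicate] at hbc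
    have hMW := Nat.mul_le_mul_right (P.weight.eval M) (hM c)
    obtain ⟨S₁, e₁, h1, h2⟩ : ∃ S₁, StackProg.Exec (.push .ctl false) (w, F) S₁ 1 ∧ S₁.1 = w ∧
        S₁.2 = Function.update F .ctl (false :: L) :=
      ⟨_, .push _ _ _, rfl, by rw [show (w, F).2 .ctl = L from hF.ctl]⟩
    obtain ⟨S₂, e₂, k1, k2, k3, k4⟩ := StackProg.exec_transfer (k := .cst c) (k' := .tmp₁) (by simp)
      S₁ (n := N c) (m := 0) (by rw [h2]; simpa using hF.cst c) (by rw [h2]; simpa using hF.tmp₁)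
    obtain ⟨⟨w₃, F₃⟩, e₃, l1, l2, l3, l4, l5⟩ := exec_loop_count c S₂ k3 (m := 0) k2 rfl
    obtain rfl : w₃ = w := (l1.trans k1).trans h1
    have l4' : F₃ .ctl = List.replicate (N c) true ++ false :: L := by
      refine l4.trans ?_
      rw [k4 _ (by simp) (by simp), h2]
      simp
    have hj : ∀ j, j ≠ .ctl → F₃ j = F j := by
      intro j hj
      by_cases j₁ : j = .tmp₁
      · rw [j₁, hF.tmp₁]
        exact l2
      by_cases j₂ : j = .cst c
      · rw [j₂, hF.cst]
        exact l3
      refine (l5 j j₁ j₂ hj).trans ?_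
      rw [k4 j j₂ j₁, h2, Function.update_of_ne hj]
    have hF₃ : Rep N (List.replicate (N c) true ++ false :: L) F₃ s :=
      ⟨by rw [hj _ (by simp), hF.out], l4', by rw [hj _ (by simp), hF.tmp₁],
        by rw [hj _ (by simp), hF.tmp₂], fun c => by rw [hj _ (by simp), hF.cst],
        fun x => by rw [hj _ (by simp), hF.ctr], fun y i => by rw [hj _ (by simp), hF.arr]⟩
    have hpop : ∀ {b : Bool} {L : List Bool} {F : Reg C X Y → List Bool} {s : LoopState X Y},
        Rep N (b :: L) F s → ∃ F', StackProg.Exec (.pop .ctl) (w₃, F) (w₃, F') 1 ∧ Rep N L F' s ∧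
          ∀ k, k ≠ .ctl → F' k = F k := by
      intro b L F s hF
      refine ⟨_, .pop _ _, ⟨?_, ?_, ?_, ?_, ?_, ?_, ?_⟩, fun k hk => Function.update_of_ne hk _ _⟩
      · simp [hF.out]
      · simp [hF.ctl]
      · simp [hF.tmp₁]
      · simp [hF.tmp₂]
      · simp [hF.cst]
      · simp [hF.ctr]
      · intro y i
        simpa using hF.arr y i
    -- Induction on the remaining iterations, which are the entries `true` above the marker; the
    -- height bound `B` grows by one weight of the body per iteration.
    have hloop : ∀ (n : ℕ) (F : Reg C X Y → List Bool) (s : LoopState X Y) (B : ℕ),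
        Rep N (List.replicate n true ++ false :: L) F s →
        (∀ k, k ≠ .ctl → (F k).length ≤ B) → B + n * P.weight.eval M ≤ B' →
        ∃ F' t, StackProg.Exec (.loop .ctl (fun o => o == some true)
          (.seq (.pop .ctl) P.compile)) (w₃, F) (w₃, F') t ∧
          Rep N (false :: L) F' ((P.eval N)^[n] s) ∧
          (∀ k, k ≠ .ctl → (F' k).length ≤ B + n * P.weight.eval M) ∧
          t ≤ n * (P.weight.eval M * (B' + 1) + 2) + 1 := by
      intro n
      induction n with
      | zero =>
        intro F s B hF hB _
        refine ⟨F, 1, .loop_false ?_, hF, fun k hk => (hB k hk).trans (Nat.le_add_right _ _),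
          by simp⟩
        simp [hF.ctl]
      | succ n ihn =>
        intro F s B hF hB hB'
        rw [add_mul, one_mul] at hB'
        obtain ⟨F₁, e₁, r₁, hj₁⟩ := hpop (L := List.replicate n true ++ false :: L) (b := true)
          (by simpa [List.replicate_succ] using hF)
        obtain ⟨F₂, t₂, e₂, r₂, b₂, c₂⟩ := ih _ F₁ s B r₁
          (fun k hk => by rw [hj₁ k hk]; exact hB k hk) (by omega)
        obtain ⟨F₃, t₃, e₃, r₃, b₃, c₃⟩ := ihn F₂ _ _ r₂ b₂ (by omega)
        refine ⟨F₃, _, .loop_true ?_ (e₁.seq e₂) e₃, r₃, fun k hk => (b₃ k hk).trans ?_, ?_⟩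
        · simp [hF.ctl, List.replicate_succ]
        · rw [add_mul, one_mul]
          omega
        · rw [add_mul n]
          omega
    obtain ⟨F₄, t₄, e₄, r₄, b₄, c₄⟩ := hloop (N c) F₃ s B hF₃
      (fun k hk => by rw [hj k hk]; exact hB k hk) (by omega)
    obtain ⟨F₅, e₅, r₅, hj₅⟩ := hpop r₄
    refine ⟨F₅, _, (e₁.seq e₂).seq (e₃.seq (e₄.seq e₅)), r₅, fun k hk => ?_, ?_⟩
    · rw [hj₅ k hk]
      exact (b₄ k hk).trans (by omega)
    · have h := Nat.mul_le_mul_right (P.weight.eval M * (B' + 1)) (hM c)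
      rw [Nat.mul_add] at c₄
      rw [add_mul, mul_assoc]
      omega

end LoopProg

namespace LoopProg

variable {C X Y : Type} [DecidableEq X] [DecidableEq Y] {N : C → ℕ}

theorem eval_inc (x : X) (s : LoopState X Y) :
    (inc x : LoopProg C X Y).eval N s = ⟨Function.update s.ctr x (s.ctr x + 1), s.arr⟩ := rfl

theorem eval_clear (x : X) (s : LoopState X Y) :
    (clear x : LoopProg C X Y).eval N s = ⟨Function.update s.ctr x 0, s.arr⟩ := rfl

theorem eval_iflt (x x' : X) (P Q : LoopProg C X Y) (s : LoopState X Y) :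
    (iflt x x' P Q).eval N s = if s.ctr x < s.ctr x' then P.eval N s else Q.eval N s := rfl

theorem eval_ifbit (y : Y) (x : X) (P Q : LoopProg C X Y) (s : LoopState X Y) :
    (ifbit y x P Q).eval N s = if s.arr y (s.ctr x) = true then P.eval N s else Q.eval N s := rfl

theorem eval_setbit (y : Y) (x : X) (s : LoopState X Y) :
    (setbit y x : LoopProg C X Y).eval N s =
      ⟨s.ctr, Function.update s.arr y (Function.update (s.arr y) (s.ctr x) true)⟩ := rfl

theorem eval_skip (s : LoopState X Y) : (skip : LoopProg C X Y).eval N s = s := rfl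

theorem eval_seq (P Q : LoopProg C X Y) (s : LoopState X Y) :
    (seq P Q).eval N s = Q.eval N (P.eval N s) := rfl

/-! ### Frame rules and invariants of loop programs -/

/-- Whether a loop program may change a counter. -/
def changesCtr : LoopProg C X Y → X → Bool
  | inc x, z | clear x, z => z = x
  | iflt _ _ P Q, z | ifbit _ _ P Q, z | seq P Q, z => changesCtr P z || changesCtr Q z
  | setbit _ _, _ | skip, _ => false
  | loop _ P, z => changesCtr P z

/-- Whether a loop program may change an array. -/
def changesArr : LoopProg C X Y → Y → Bool
  | inc _, _ | clear _, _ | skip, _ => false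
  | iflt _ _ P Q, z | ifbit _ _ P Q, z | seq P Q, z => changesArr P z || changesArr Q z
  | setbit y _, z => z = y
  | loop _ P, z => changesArr P z

/-- The syntactic test is computable, so for concrete programs the frame conditions hold by `rfl`.
-/
theorem eval_ctr_of_changesCtr {P : LoopProg C X Y} {z : X} (h : P.changesCtr z = false)
    (s : LoopState X Y) : (P.eval N s).ctr z = s.ctr z := by
  induction P generalizing s with
  | inc x | clear x =>
    simp only [changesCtr, decide_eq_false_iff_not] at h
    simp [eval, Function.update_of_ne h]
  | setbit y x => rfl
  | skip => rfl
  | iflt x x' P Q ihP ihQ =>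
    simp only [changesCtr, Bool.or_eq_false_iff] at h
    simp only [eval]
    split
    exacts [ihP h.1 s, ihQ h.2 s]
  | ifbit y x P Q ihP ihQ =>
    simp only [changesCtr, Bool.or_eq_false_iff] at h
    simp only [eval]
    split
    exacts [ihP h.1 s, ihQ h.2 s]
  | seq P Q ihP ihQ =>
    simp only [changesCtr, Bool.or_eq_false_iff] at h
    exact (ihQ h.2 _).trans (ihP h.1 s)
  | loop c P ih =>
    simp only [eval]
    induction N c generalizing s with
    | zero => rfl
    | succ n ihn => rw [Function.iterate_succ_apply, ihn, ih h]

theorem eval_arr_of_changesArr {P : LoopProg C X Y} {z : Y} (h : P.changesArr z = false)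
    (s : LoopState X Y) : (P.eval N s).arr z = s.arr z := by
  induction P generalizing s with
  | inc x | clear x | skip => rfl
  | setbit y x =>
    simp only [changesArr, decide_eq_false_iff_not] at h
    simp [eval, Function.update_of_ne h]
  | iflt x x' P Q ihP ihQ =>
    simp only [changesArr, Bool.or_eq_false_iff] at h
    simp only [eval]
    split
    exacts [ihP h.1 s, ihQ h.2 s]
  | ifbit y x P Q ihP ihQ =>
    simp only [changesArr, Bool.or_eq_false_iff] at h
    simp only [eval]
    split
    exacts [ihP h.1 s, ihQ h.2 s]
  | seq P Q ihP ihQ =>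
    simp only [changesArr, Bool.or_eq_false_iff] at h
    exact (ihQ h.2 _).trans (ihP h.1 s)
  | loop c P ih =>
    simp only [eval]
    induction N c generalizing s with
    | zero => rfl
    | succ n ihn => rw [Function.iterate_succ_apply, ihn, ih h]

theorem eval_loop_invariant {P : LoopProg C X Y} {c : C} (I : ℕ → LoopState X Y → Prop)
    {s : LoopState X Y} (h₀ : I 0 s) (h : ∀ j < N c, ∀ s, I j s → I (j + 1) (P.eval N s)) :
    I (N c) ((loop c P).eval N s) := by
  have : ∀ j ≤ N c, I j ((P.eval N)^[j] s) := by
    intro j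
    induction j with
    | zero => exact fun _ => h₀
    | succ j ih =>
      intro hj
      rw [Function.iterate_succ_apply']
      exact h j (by omega) _ (ih (by omega))
  exact this _ le_rfl

/-- The loop over the values `0, 1, …` of the counter `x`, as many as the register `c` says. -/
def forLoop (c : C) (x : X) (P : LoopProg C X Y) : LoopProg C X Y :=
  seq (clear x) (loop c (seq P (inc x)))

/-- The hypothesis `hI` says that the invariant ignores the loop counter, so resetting and
incrementing it are harmless; the body may still use that the counter equals `j`. -/
theorem eval_forLoop_invariant {P : LoopProg C X Y} {c : C} {x : X}
    (I : ℕ → LoopState X Y → Prop) {s : LoopState X Y}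
    (hI : ∀ j s v, I j s → I j { s with ctr := Function.update s.ctr x v }) (h₀ : I 0 s)
    (hx : P.changesCtr x = false)
    (h : ∀ j < N c, ∀ s, I j s → s.ctr x = j → I (j + 1) (P.eval N s)) :
    I (N c) ((forLoop c x P).eval N s) := by
  refine (eval_loop_invariant (fun j s => s.ctr x = j ∧ I j s) ⟨?_, ?_⟩ ?_).2
  · simp [eval]
  · exact hI _ _ _ h₀
  · rintro j hj s ⟨hs, hIs⟩
    refine ⟨?_, hI _ _ _ (h j hj s hIs hs)⟩
    simp [eval, eval_ctr_of_changesCtr hx, hs]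

end LoopProg

/-! ### The decision procedure as a loop program -/

namespace CGDecision

open LoopProg

/-- The read-only registers: the number of items, its successor, and the lengths of the binary
representations. -/
inductive Cst : Type
  | items
  | itemsSucc
  | lenK
  | lenD
  deriving DecidableEq

instance : Fintype Cst :=
  Fintype.ofList [.items, .itemsSucc, .lenK, .lenD] fun x => by cases x <;> simp

/-- The counters. -/
inductive Ctr : Type
  | agents
  | bound
  | neg
  | fail
  | zero
  | i
  | idx
  | aux
  | u
  | v
  | w
  | p
  | count
  deriving DecidableEq

instance : Fintype Ctr :=
  Fintype.ofList [.agents, .bound, .neg, .fail, .zero, .i, .idx, .aux, .u, .v, .w, .p, .count]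
    fun x => by cases x <;> simp

/-- The arrays: the binary representations, and the adjacency matrix. -/
inductive Arr : Type
  | bitsK
  | bitsD
  | graph
  deriving DecidableEq

instance : Fintype Arr :=
  Fintype.ofList [.bitsK, .bitsD, .graph] fun x => by cases x <;> simp

/-- Loop programs of the decision procedure. -/
abbrev Prog : Type := LoopProg Cst Ctr Arr

/-- States of the decision procedure. -/
abbrev State : Type := LoopState Ctr Arr

variable (N : Cst → ℕ)

/-! ### Truncated binary numbers -/

/-- One step of Horner's method: double `x`, add a bit of `y`, and truncate. -/
def hornerStep (y : Arr) (x : Ctr) : Prog :=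
  seq (seq (clear .idx) (seq (clear .aux)
      (loop .itemsSucc (iflt .aux x (seq (inc .aux) (seq (inc .idx) (inc .idx))) skip))))
    (seq (ifbit y .i (inc .idx) skip)
      (seq (clear x) (loop .itemsSucc (iflt x .idx (inc x) skip))))

/-- The number with the binary representation in the array `y`, truncated at the number of items
plus one, in the counter `x`. -/
def horner (y : Arr) (l : Cst) (x : Ctr) : Prog :=
  seq (clear x) (forLoop l .i (hornerStep y x))

/-- The number with the first `j` bits `a`, most significant bit first. -/
def hornerValue (a : ℕ → Bool) : ℕ → ℕ
  | 0 => 0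
  | j + 1 => 2 * hornerValue a j + (a j).toNat

theorem eval_hornerStep_ctr (y : Arr) {x : Ctr} (hx : x ≠ .idx) (hx' : x ≠ .aux)
    (s : State) : ((hornerStep y x).eval N s).ctr x =
      min (N .itemsSucc) (2 * min (N .itemsSucc) (s.ctr x) + (s.arr y (s.ctr .i)).toNat) := by
  simp only [hornerStep, eval_seq, eval_clear, eval_ifbit, eval_inc, eval_skip]
  set s₁ : State := { ctr := Function.update (Function.update s.ctr .idx 0) .aux 0, arr := s.arr }
  -- The body acts only while `aux` is less than `x`, hence `min (N .itemsSucc) x` times in all, and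
  -- each time adds two to `idx`. Such guarded loops replace loops over a counter, which loop
  -- programs lack.
  obtain ⟨h1, h2, h3, h4, h5⟩ := eval_loop_invariant (N := N) (c := .itemsSucc) (s := s₁)
    (P := iflt .aux x (seq (inc .aux) (seq (inc .idx) (inc .idx))) skip)
    (fun j s' => s'.ctr .aux = min j (s.ctr x) ∧ s'.ctr .idx = 2 * min j (s.ctr x) ∧
      s'.ctr x = s.ctr x ∧ s'.ctr .i = s.ctr .i ∧ s'.arr = s.arr)
    (by simp [s₁, Function.update_of_ne hx, Function.update_of_ne hx'])
    (by
      rintro j - s' ⟨h1, h2, h3, h4, h5⟩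
      simp only [eval_iflt, eval_seq, eval_inc, eval_skip, h1, h3]
      split
      · refine ⟨?_, ?_, ?_, ?_, h5⟩
        · simp; omega
        · simp [h2]; omega
        · simp [h3, hx, hx']
        · simp [h4]
      · exact ⟨by omega, by omega, h3, h4, h5⟩)
  set s₂ := eval N (loop .itemsSucc
    (iflt .aux x (seq (inc .aux) (seq (inc .idx) (inc .idx))) skip)) s₁
  set s₃ : State := if s₂.arr y (s₂.ctr .i) = true then
    { ctr := Function.update s₂.ctr .idx (s₂.ctr .idx + 1), arr := s₂.arr } else s₂
  have h6 : s₃.ctr .idx = 2 * min (N .itemsSucc) (s.ctr x) + (s.arr y (s.ctr .i)).toNat := by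
    simp only [s₃, h4, h5]
    split
    · rename_i hb
      simp [h2, hb]
    · rename_i hb
      simp [h2, hb]
  set s₄ : State := { ctr := Function.update s₃.ctr x 0, arr := s₃.arr }
  obtain ⟨k1, -⟩ := eval_loop_invariant (N := N) (c := .itemsSucc) (s := s₄)
    (P := iflt x .idx (inc x) skip)
    (fun j s' => s'.ctr x = min j (s₃.ctr .idx) ∧ s'.ctr .idx = s₃.ctr .idx)
    (by simp [s₄, Function.update_of_ne hx.symm])
    (by
      rintro j - s' ⟨h1, h2⟩
      simp only [eval_iflt, eval_inc, eval_skip, h1, h2]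
      split
      · refine ⟨?_, ?_⟩
        · simp; omega
        · simp [h2, Function.update_of_ne hx.symm]
      · exact ⟨by omega, h2⟩)
  rw [← h6]
  exact k1

/-- Truncating in every step is the same as truncating at the end: once a partial value reaches the
cap, doubling cannot bring it back below. -/
theorem eval_horner_ctr (y : Arr) (l : Cst) {x : Ctr} (hx : x ≠ .idx) (hx' : x ≠ .aux)
    (hx'' : x ≠ .i) (s : State) :
    ((horner y l x).eval N s).ctr x = min (N .itemsSucc) (hornerValue (s.arr y) (N l)) := by
  refine (eval_forLoop_invariant (N := N)
    (fun j s' => s'.ctr x = min (N .itemsSucc) (hornerValue (s.arr y) j) ∧ s'.arr = s.arr)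
    ?_ ?_ ?_ ?_).1
  · rintro j s' v ⟨h1, h2⟩
    exact ⟨by simp [h1, Function.update_of_ne hx''], h2⟩
  · simp [hornerValue, eval]
  · simp [hornerStep, changesCtr, hx''.symm]
  · rintro j - s' ⟨h1, h2⟩ h3
    refine ⟨?_, ?_⟩
    · rw [eval_hornerStep_ctr N y hx hx', h1, h2, h3, hornerValue]
      omega
    · funext z
      rw [eval_arr_of_changesArr (by rfl), h2]

/-! ### Addressing the entries of the matrix -/

/-- The position of the entry `(x, x')` of the adjacency matrix, in the counter `idx`. -/
def position (x x' : Ctr) : Prog :=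
  seq (seq (clear .idx) (seq (clear .aux)
      (loop .items (iflt .aux x (seq (inc .aux) (loop .items (inc .idx))) skip))))
    (seq (clear .aux) (loop .items (iflt .aux x' (seq (inc .aux) (inc .idx)) skip)))

theorem eval_position_ctr {x x' : Ctr} (hx : x ≠ .idx) (hx₁ : x ≠ .aux) (hx' : x' ≠ .idx)
    (hx'₁ : x' ≠ .aux) (s : State) (h : s.ctr x ≤ N .items) (h' : s.ctr x' ≤ N .items) :
    ((position x x').eval N s).ctr .idx = s.ctr x * N .items + s.ctr x' := by
  simp only [position, eval_seq, eval_clear]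
  set s₁ : State := { ctr := Function.update (Function.update s.ctr .idx 0) .aux 0, arr := s.arr }
  have hinc : ∀ s : State, (loop .items (inc Ctr.idx)).eval N s =
      { s with ctr := Function.update s.ctr .idx (s.ctr .idx + N .items) } := by
    intro s
    simp only [eval]
    induction N .items with
    | zero => simp
    | succ n ih =>
      rw [Function.iterate_succ_apply', ih]
      simp [add_assoc]
  obtain ⟨h1, h2, h3, h4⟩ := eval_loop_invariant (N := N) (c := .items) (s := s₁)
    (P := iflt .aux x (seq (inc .aux) (loop .items (inc .idx))) skip)
    (fun j s' => s'.ctr .aux = min j (s.ctr x) ∧ s'.ctr .idx = min j (s.ctr x) * N .items ∧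
      s'.ctr x = s.ctr x ∧ s'.ctr x' = s.ctr x')
    (by simp [s₁, hx, hx', hx₁, hx'₁])
    (by
      rintro j - s' ⟨h1, h2, h3, h4⟩
      simp only [eval_iflt, eval_seq, eval_inc, eval_skip, h1, h3, hinc]
      split
      · refine ⟨?_, ?_, ?_, ?_⟩
        · simp; omega
        · rw [show min (j + 1) (s.ctr x) = min j (s.ctr x) + 1 by omega, add_mul]
          simp [h2]
        · simp [h3, hx, hx₁]
        · simp [h4, hx', hx'₁]
      · rw [show min (j + 1) (s.ctr x) = min j (s.ctr x) by omega]
        exact ⟨h1, h2, h3, h4⟩)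
  set s₂ := eval N (loop .items
    (iflt .aux x (seq (inc .aux) (loop .items (inc .idx))) skip)) s₁
  set s₃ : State := { ctr := Function.update s₂.ctr .aux 0, arr := s₂.arr }
  obtain ⟨-, k2, -⟩ := eval_loop_invariant (N := N) (c := .items) (s := s₃)
    (P := iflt .aux x' (seq (inc .aux) (inc .idx)) skip)
    (fun j s' => s'.ctr .aux = min j (s.ctr x') ∧
      s'.ctr .idx = s.ctr x * N .items + min j (s.ctr x') ∧ s'.ctr x' = s.ctr x')
    (by simp [s₃, hx'₁, h2, h4, h])
    (by
      rintro j - s' ⟨h1, h2, h3⟩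
      simp only [eval_iflt, eval_seq, eval_inc, eval_skip, h1, h3]
      split
      · refine ⟨?_, ?_, ?_⟩
        · simp; omega
        · simp [h2]; omega
        · simp [h3, hx', hx'₁]
      · rw [show min (j + 1) (s.ctr x') = min j (s.ctr x') by omega]
        exact ⟨h1, h2, h3⟩)
  rw [min_eq_right h'] at k2
  exact k2

end CGDecision

namespace CGDecision

open LoopProg

variable (N : Cst → ℕ)

/-! ### The reflexive transitive closure -/

/-- The entry `(a, b)` of the matrix of a state. -/
def Edge (s : State) (a b : ℕ) : Prop := s.arr .graph (a * N .items + b) = true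

/-- Make the graph reflexive. -/
def addLoops : Prog := forLoop .items .u (seq (position .u .u) (setbit .graph .idx))

/-- Add the edge `(u, v)` if there are edges `(u, p)` and `(p, v)`. -/
def pivotStep : Prog :=
  seq (position .u .p) (ifbit .graph .idx (seq (position .p .v)
    (ifbit .graph .idx (seq (position .u .v) (setbit .graph .idx)) skip)) skip)

/-- Add all edges `(u, v)` such that there are edges `(u, p)` and `(p, v)`. -/
def pivot : Prog := forLoop .items .u (forLoop .items .v pivotStep)

/-- Replace the graph by its reflexive transitive closure, by Warshall's algorithm. -/
def closure : Prog := seq addLoops (forLoop .items .p pivot)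

variable {N}

theorem edge_congr {s s' : State} (h : s.arr .graph = s'.arr .graph) (a b : ℕ) :
    Edge N s a b ↔ Edge N s' a b := by
  simp only [Edge, h]

theorem mul_add_inj {n a b c d : ℕ} (hb : b < n) (hd : d < n) (h : a * n + b = c * n + d) :
    a = c ∧ b = d := by
  have hn : 0 < n := by omega
  have h₁ : (a * n + b) / n = (c * n + d) / n := by rw [h]
  have h₂ : (a * n + b) % n = (c * n + d) % n := by rw [h]
  rw [add_comm (a * n), add_comm (c * n), Nat.add_mul_div_right _ _ hn,
    Nat.add_mul_div_right _ _ hn, Nat.div_eq_of_lt hb, Nat.div_eq_of_lt hd] at h₁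
  rw [Nat.mul_add_mod_self_right, Nat.mul_add_mod_self_right, Nat.mod_eq_of_lt hb,
    Nat.mod_eq_of_lt hd] at h₂
  omega

/-- Column indices below `N .items` make the row-by-row address injective, so exactly one entry is
affected. -/
theorem edge_eval_setbit {s : State} {a b c d : ℕ} (hb : b < N .items) (hd : d < N .items)
    (h : s.ctr .idx = a * N .items + b) :
    Edge N ((setbit .graph .idx).eval N s) c d ↔ Edge N s c d ∨ c = a ∧ d = b := by
  simp only [Edge, eval_setbit, Function.update_self, h]
  by_cases hcd : c * N .items + d = a * N .items + b
  · simp [mul_add_inj hd hb hcd]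
  · rw [Function.update_of_ne hcd]
    constructor
    · exact Or.inl
    · rintro (h | ⟨rfl, rfl⟩)
      · exact h
      · exact absurd rfl hcd

theorem eval_position_graph (x x' : Ctr) (s : State) :
    ((position x x').eval N s).arr .graph = s.arr .graph :=
  eval_arr_of_changesArr (by rfl) s

theorem edge_eval_addLoops (s : State) {a b : ℕ} (ha : a < N .items) (hb : b < N .items) :
    Edge N (addLoops.eval N s) a b ↔ Edge N s a b ∨ a = b := by
  have := eval_forLoop_invariant (N := N) (c := .items) (x := .u) (s := s)
    (P := seq (position .u .u) (setbit .graph .idx))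
    (fun j s' => ∀ a < N .items, ∀ b < N .items, Edge N s' a b ↔ Edge N s a b ∨ a = b ∧ a < j)
    (fun j s' v h => h) (by simp) (by rfl) (by
      intro j hj s' h hu a ha b hb
      rw [eval_seq, edge_eval_setbit (a := j) (b := j) hj hb
        (by rw [eval_position_ctr N (by simp) (by simp) (by simp) (by simp) _ (by omega) (by omega),
          hu]),
        edge_congr (eval_position_graph _ _ _), h a ha b hb]
      constructor
      · rintro ((h | h) | h)
        exacts [Or.inl h, Or.inr (by omega), Or.inr (by omega)]
      · rintro (h | h)
        · exact Or.inl (Or.inl h)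
        · by_cases haj : a = j
          · exact Or.inr (by omega)
          · exact Or.inl (Or.inr (by omega)))
  refine (this a ha b hb).trans ⟨?_, ?_⟩
  · rintro (h | h)
    exacts [Or.inl h, Or.inr h.1]
  · rintro (h | h)
    exacts [Or.inl h, Or.inr ⟨h, ha⟩]

theorem edge_eval_pivotStep {s : State} (hu : s.ctr .u < N .items) (hv : s.ctr .v < N .items)
    (hp : s.ctr .p < N .items) {a b : ℕ} (hb : b < N .items) :
    Edge N (pivotStep.eval N s) a b ↔ Edge N s a b ∨
      a = s.ctr .u ∧ b = s.ctr .v ∧ Edge N s a (s.ctr .p) ∧ Edge N s (s.ctr .p) b := by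
  have hctr : ∀ {x x' z : Ctr} (s : State), z ≠ .idx → z ≠ .aux →
      ((position x x').eval N s).ctr z = s.ctr z := fun s h h' =>
    eval_ctr_of_changesCtr (by simp [position, changesCtr, h, h']) s
  have hidx : ∀ {x x' : Ctr} {s' : State}, x ≠ .idx → x ≠ .aux → x' ≠ .idx → x' ≠ .aux →
      s'.ctr x = s.ctr x → s'.ctr x' = s.ctr x' → s.ctr x < N .items → s.ctr x' < N .items →
      ((position x x').eval N s').ctr .idx = s.ctr x * N .items + s.ctr x' := by
    intro x x' s' h1 h2 h3 h4 h5 h6 h7 h8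
    rw [eval_position_ctr N h1 h2 h3 h4 s' (by omega) (by omega), h5, h6]
  simp only [pivotStep, eval_seq, eval_ifbit, eval_skip]
  set s₁ := (position .u .p).eval N s
  have e₁ : s₁.arr .graph = s.arr .graph := eval_position_graph _ _ _
  have i₁ : s₁.ctr .idx = s.ctr .u * N .items + s.ctr .p :=
    hidx (by simp) (by simp) (by simp) (by simp) rfl rfl hu hp
  have c₁ : ∀ z, z ≠ .idx → z ≠ .aux → s₁.ctr z = s.ctr z := fun z => hctr s
  set s₂ := (position .p .v).eval N s₁
  have e₂ : s₂.arr .graph = s.arr .graph := (eval_position_graph _ _ _).trans e₁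
  have i₂ : s₂.ctr .idx = s.ctr .p * N .items + s.ctr .v :=
    hidx (by simp) (by simp) (by simp) (by simp) (c₁ _ (by simp) (by simp))
      (c₁ _ (by simp) (by simp)) hp hv
  have c₂ : ∀ z, z ≠ .idx → z ≠ .aux → s₂.ctr z = s.ctr z := fun z h h' =>
    (hctr s₁ h h').trans (c₁ z h h')
  set s₃ := (position .u .v).eval N s₂
  have e₃ : s₃.arr .graph = s.arr .graph := (eval_position_graph _ _ _).trans e₂
  have i₃ : s₃.ctr .idx = s.ctr .u * N .items + s.ctr .v :=
    hidx (by simp) (by simp) (by simp) (by simp) (c₂ _ (by simp) (by simp))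
      (c₂ _ (by simp) (by simp)) hu hv
  rw [e₁, e₂, i₁, i₂]
  split
  · rename_i h₁
    split
    · rename_i h₂
      rw [edge_eval_setbit hv hb i₃, edge_congr e₃]
      refine or_congr_right ⟨?_, fun h => ⟨h.1, h.2.1⟩⟩
      rintro ⟨rfl, rfl⟩
      exact ⟨rfl, rfl, h₁, h₂⟩
    · rename_i h₂
      rw [edge_congr e₂]
      refine ⟨Or.inl, ?_⟩
      rintro (h | ⟨-, rfl, -, h⟩)
      exacts [h, absurd h h₂]
  · rename_i h₁
    rw [edge_congr e₁]
    refine ⟨Or.inl, ?_⟩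
    rintro (h | ⟨rfl, -, h, -⟩)
    exacts [h, absurd h h₁]

/-- Updating in place is harmless because row and column `p` never change: a new edge `(a, p)`
through `p` would require the old edge `(a, p)`, and likewise for `(p, b)`. -/
theorem edge_eval_pivot {s : State} (hp : s.ctr .p < N .items) {a b : ℕ} (ha : a < N .items)
    (hb : b < N .items) : Edge N (pivot.eval N s) a b ↔
      Edge N s a b ∨ Edge N s a (s.ctr .p) ∧ Edge N s (s.ctr .p) b := by
  -- The last clause covers the pairs that precede `(k, l)` lexicographically, that is, those
  -- already treated by the double loop.
  let J : ℕ → ℕ → State → Prop := fun k l s' => s'.ctr .p = s.ctr .p ∧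
    ∀ a < N .items, ∀ b < N .items, (Edge N s a b → Edge N s' a b) ∧
      (Edge N s' a b → Edge N s a b ∨ Edge N s a (s.ctr .p) ∧ Edge N s (s.ctr .p) b) ∧
      (a < k ∨ a = k ∧ b < l → Edge N s a (s.ctr .p) → Edge N s (s.ctr .p) b → Edge N s' a b)
  have key : J (N .items) 0 (pivot.eval N s) := by
    refine eval_forLoop_invariant (N := N) (fun k s' => J k 0 s') ?_ ?_ (by rfl) ?_
    · exact fun k s' v h => ⟨by simpa using h.1, h.2⟩
    · exact ⟨rfl, fun a _ b _ => ⟨id, Or.inl, by omega⟩⟩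
    · intro k hk s' hs' hu
      have h := eval_forLoop_invariant (N := N) (c := .items) (x := .v) (P := pivotStep) (s := s')
        (fun l s' => s'.ctr .u = k ∧ J k l s')
        (fun k s' v h => ⟨by simpa using h.1, by simpa using h.2.1, h.2.2⟩) ⟨hu, hs'⟩ (by rfl) (by
          rintro l hl s' ⟨hu, hp', h⟩ hv
          refine ⟨(eval_ctr_of_changesCtr (by rfl) _).trans hu,
            (eval_ctr_of_changesCtr (by rfl) _).trans hp', fun a ha b hb => ?_⟩
          obtain ⟨h1, h2, h3⟩ := h a ha b hb
          have hap := (h a ha _ hp).2.1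
          have hpb := (h _ hp b hb).2.1
          have hap' := (h a ha _ hp).1
          have hpb' := (h _ hp b hb).1
          rw [edge_eval_pivotStep (by omega) (by omega) (by omega) hb, hp', hu, hv]
          refine ⟨fun hab => Or.inl (h1 hab), ?_, ?_⟩
          · rintro (hab | ⟨-, -, h4, h5⟩)
            · exact h2 hab
            · exact Or.inr ⟨(hap h4).elim id (·.1), (hpb h5).elim id (·.2)⟩
          · intro hab h4 h5
            by_cases hkl : a = k ∧ b = l
            · exact Or.inr ⟨hkl.1, hkl.2, hap' h4, hpb' h5⟩
            · exact Or.inl (h3 (by omega) h4 h5))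
      refine ⟨h.2.1, fun a ha b hb => ?_⟩
      obtain ⟨h1, h2, h3⟩ := h.2.2 a ha b hb
      exact ⟨h1, h2, fun _ => h3 (by omega)⟩
  obtain ⟨h1, h2, h3⟩ := key.2 a ha b hb
  exact ⟨h2, fun h => h.elim h1 fun h => h3 (Or.inl ha) h.1 h.2⟩

/-- Warshall's invariant, in the form of transitivity through the middle vertices `b < k`: each
pivot adds one admissible middle vertex. Every edge stays inside any reflexive and transitive `T`
that contains the graph. -/
theorem edge_eval_closure (s : State) {T : ℕ → ℕ → Prop} (hrefl : ∀ a, T a a)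
    (htrans : ∀ a b c, T a b → T b c → T a c)
    (hT : ∀ a < N .items, ∀ b < N .items, Edge N s a b → T a b) :
    (∀ a < N .items, Edge N (closure.eval N s) a a) ∧
    (∀ a < N .items, ∀ b < N .items, Edge N s a b → Edge N (closure.eval N s) a b) ∧
    (∀ a < N .items, ∀ b < N .items, ∀ c < N .items, Edge N (closure.eval N s) a b →
      Edge N (closure.eval N s) b c → Edge N (closure.eval N s) a c) ∧
    (∀ a < N .items, ∀ b < N .items, Edge N (closure.eval N s) a b → T a b) := by
  have key := eval_forLoop_invariant (N := N) (c := .items) (x := .p) (P := pivot)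
    (s := addLoops.eval N s) (fun k s' => (∀ a < N .items, Edge N s' a a) ∧
      (∀ a < N .items, ∀ b < N .items, Edge N s a b → Edge N s' a b) ∧
      (∀ a < N .items, ∀ b < k, ∀ c < N .items, Edge N s' a b → Edge N s' b c → Edge N s' a c) ∧
      (∀ a < N .items, ∀ b < N .items, Edge N s' a b → T a b))
    (fun _ _ _ h => h)
    (by
      refine ⟨fun a ha => (edge_eval_addLoops s ha ha).2 (Or.inr rfl),
        fun a ha b hb h => (edge_eval_addLoops s ha hb).2 (Or.inl h), by omega,
        fun a ha b hb h => ?_⟩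
      rcases (edge_eval_addLoops s ha hb).1 h with h | rfl
      exacts [hT a ha b hb h, hrefl a]) (by rfl)
    (by
      rintro k hk s' ⟨h1, h2, h3, h4⟩ hp
      have hpiv : ∀ {a b}, a < N .items → b < N .items → (Edge N (pivot.eval N s') a b ↔
          Edge N s' a b ∨ Edge N s' a k ∧ Edge N s' k b) := fun ha hb => by
        rw [edge_eval_pivot (by omega) ha hb, hp]
      refine ⟨fun a ha => (hpiv ha ha).2 (Or.inl (h1 a ha)),
        fun a ha b hb h => (hpiv ha hb).2 (Or.inl (h2 a ha b hb h)),
        fun a ha b hb c hc h h' => ?_, fun a ha b hb h => ?_⟩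
      · have hbn : b < N .items := by omega
        rw [hpiv ha hbn] at h
        rw [hpiv hbn hc] at h'
        rw [hpiv ha hc]
        by_cases hbk : b = k
        · subst hbk
          exact Or.inr ⟨h.elim id (·.1), h'.elim id (·.2)⟩
        · have hbk' : b < k := by omega
          rcases h with h | h <;> rcases h' with h' | h'
          · exact Or.inl (h3 a ha b hbk' c hc h h')
          · exact Or.inr ⟨h3 a ha b hbk' k hk h h'.1, h'.2⟩
          · exact Or.inr ⟨h.1, h3 k hk b hbk' c hc h.2 h'⟩
          · exact Or.inr ⟨h.1, h'.2⟩
      · rcases (hpiv ha hb).1 h with h | h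
        · exact h4 a ha b hb h
        · exact htrans a k b (h4 a ha k hk h.1) (h4 k hk b hb h.2))
  exact key

/-- The loop program `closure` computes the least reflexive and transitive relation that contains
the graph. -/
theorem edge_eval_closure_iff (s : State) {T : ℕ → ℕ → Prop} (hrefl : ∀ a, T a a)
    (htrans : ∀ a b c, T a b → T b c → T a c)
    (hT : ∀ a < N .items, ∀ b < N .items, Edge N s a b → T a b)
    (hmin : ∀ Q : ℕ → ℕ → Prop, (∀ a < N .items, Q a a) →
      (∀ a < N .items, ∀ b < N .items, Edge N s a b → Q a b) →
      (∀ a < N .items, ∀ b < N .items, ∀ c < N .items, Q a b → Q b c → Q a c) →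
      ∀ a < N .items, ∀ b < N .items, T a b → Q a b) {a b : ℕ} (ha : a < N .items)
    (hb : b < N .items) : Edge N (closure.eval N s) a b ↔ T a b := by
  obtain ⟨h1, h2, h3, h4⟩ := edge_eval_closure s hrefl htrans hT
  exact ⟨h4 a ha b hb, hmin _ h1 h2 h3 a ha b hb⟩

/-! ### Counting undominated items -/

/-- Count an item `w` that is not dominated by `u` and `v`. -/
def countStep : Prog :=
  seq (position .u .w) (ifbit .graph .idx skip
    (seq (position .v .w) (ifbit .graph .idx skip (inc .count))))

/-- Count the items that are not dominated by `u` and `v`. -/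
def countUndominated : Prog := seq (clear .count) (forLoop .items .w countStep)

-- The case in which `u` and `v` hold the same item accounts for the sets of a single item.
open Classical in
theorem eval_countUndominated (s : State) (hu : s.ctr .u < N .items) (hv : s.ctr .v < N .items) :
    (countUndominated.eval N s).ctr .count = ((Finset.range (N .items)).filter fun w =>
      ¬ Edge N s (s.ctr .u) w ∧ ¬ Edge N s (s.ctr .v) w).card := by
  refine (eval_forLoop_invariant (N := N) (fun (j : ℕ) (s' : State) => s'.ctr .u = s.ctr .u ∧
    s'.ctr .v = s.ctr .v ∧ s'.arr .graph = s.arr .graph ∧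
    s'.ctr .count = ((Finset.range j).filter fun w =>
      ¬ Edge N s (s.ctr .u) w ∧ ¬ Edge N s (s.ctr .v) w).card) ?_ ?_ (by rfl) ?_).2.2.2
  · intro j s' v h
    simpa using h
  · simp [eval_clear]
  · rintro j hj s' ⟨h1, h2, h3, h4⟩ hw
    refine ⟨(eval_ctr_of_changesCtr (by rfl) _).trans h1,
      (eval_ctr_of_changesCtr (by rfl) _).trans h2,
      (eval_arr_of_changesArr (by rfl) _).trans h3, ?_⟩
    rw [Finset.range_add_one, Finset.filter_insert]
    simp only [countStep, eval_seq, eval_ifbit, eval_skip]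
    set s₁ := (position .u .w).eval N s'
    have i₁ : s₁.ctr .idx = s.ctr .u * N .items + j := by
      rw [eval_position_ctr N (by simp) (by simp) (by simp) (by simp) _ (by omega) (by omega),
        h1, hw]
    have c₁ : s₁.ctr .v = s.ctr .v := (eval_ctr_of_changesCtr (by rfl) _).trans h2
    have w₁ : s₁.ctr .w = j := (eval_ctr_of_changesCtr (by rfl) _).trans hw
    have e₁ : s₁.arr .graph = s.arr .graph := (eval_position_graph _ _ _).trans h3
    have n₁ : s₁.ctr .count = s'.ctr .count := eval_ctr_of_changesCtr (by rfl) _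
    set s₂ := (position .v .w).eval N s₁
    have i₂ : s₂.ctr .idx = s.ctr .v * N .items + j := by
      rw [eval_position_ctr N (by simp) (by simp) (by simp) (by simp) _ (by omega) (by omega),
        c₁, w₁]
    have e₂ : s₂.arr .graph = s.arr .graph := (eval_position_graph _ _ _).trans e₁
    have n₂ : s₂.ctr .count = s'.ctr .count := (eval_ctr_of_changesCtr (by rfl) _).trans n₁
    rw [e₁, e₂, i₁, i₂]
    by_cases hE : s.arr .graph (s.ctr .u * N .items + j) = true
    · rw [if_pos hE, if_neg (fun h => h.1 hE), n₁, h4]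
    · rw [if_neg hE]
      by_cases hE' : s.arr .graph (s.ctr .v * N .items + j) = true
      · rw [if_pos hE', if_neg (fun h => h.2 hE'), n₂, h4]
      · rw [if_neg hE', if_pos ⟨hE, hE'⟩, Finset.card_insert_of_notMem (by simp), eval_inc]
        simp [n₂, h4]

/-! ### The decision procedure -/

/-- Register a failure if `count` is greater than the bound on the dissatisfaction, but less than
the number of agents. -/
def check : Prog := iflt .count .agents (iflt .count .bound skip (inc .fail)) skip

/-- Read the two numbers: the number of agents, and the least number that is greater than the bound
on the dissatisfaction. -/
def readNumbers : Prog :=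
  seq (horner .bitsK .lenK .agents) (seq (horner .bitsD .lenD .bound)
    (iflt .zero .neg (clear .bound) (inc .bound)))

/-- Check the empty set. -/
def checkEmpty : Prog := seq (seq (clear .count) (loop .items (inc .count))) check

/-- Check the sets of one or two items. -/
def checkPairs : Prog := forLoop .items .u (forLoop .items .v (seq countUndominated check))

/-- The decision procedure. -/
def decision : Prog := seq readNumbers (seq closure (seq checkEmpty checkPairs))

theorem eval_check_fail (s : State) : (check.eval N s).ctr .fail = 0 ↔ s.ctr .fail = 0 ∧
    ¬ (s.ctr .count < s.ctr .agents ∧ ¬ s.ctr .count < s.ctr .bound) := by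
  simp only [check, eval_iflt, eval_skip, eval_inc]
  split_ifs <;> simp [*]

/-- The increment turns the test `count ≤ d` into the available strict comparison, and the value `0`
makes it fail always when `d` is negative. -/
theorem eval_readNumbers (s : State) (hzero : s.ctr .zero = 0) :
    (readNumbers.eval N s).ctr .agents =
        min (N .itemsSucc) (hornerValue (s.arr .bitsK) (N .lenK)) ∧
      (readNumbers.eval N s).ctr .bound = if s.ctr .neg = 0 then
        min (N .itemsSucc) (hornerValue (s.arr .bitsD) (N .lenD)) + 1 else 0 := by
  simp only [readNumbers, eval_seq]
  set s₁ := (horner .bitsK .lenK .agents).eval N s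
  have a₁ : s₁.ctr .agents = _ :=
    eval_horner_ctr N .bitsK .lenK (x := .agents) (by simp) (by simp) (by simp) s
  have z₁ : s₁.ctr .zero = s.ctr .zero := eval_ctr_of_changesCtr (by rfl) _
  have n₁ : s₁.ctr .neg = s.ctr .neg := eval_ctr_of_changesCtr (by rfl) _
  have d₁ : s₁.arr .bitsD = s.arr .bitsD := eval_arr_of_changesArr (by rfl) _
  set s₂ := (horner .bitsD .lenD .bound).eval N s₁
  have b₂ : s₂.ctr .bound = _ :=
    eval_horner_ctr N .bitsD .lenD (x := .bound) (by simp) (by simp) (by simp) s₁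
  have a₂ : s₂.ctr .agents = s₁.ctr .agents := eval_ctr_of_changesCtr (by rfl) _
  have z₂ : s₂.ctr .zero = s.ctr .zero := (eval_ctr_of_changesCtr (by rfl) _).trans z₁
  have n₂ : s₂.ctr .neg = s.ctr .neg := (eval_ctr_of_changesCtr (by rfl) _).trans n₁
  refine ⟨(eval_ctr_of_changesCtr (by rfl) s₂).trans (a₂.trans a₁), ?_⟩
  · rw [eval_iflt, z₂, n₂, hzero]
    split_ifs with h h' <;> simp [eval_clear, eval_inc, b₂, d₁] <;> omega

open Classical in
/-- The decision procedure registers no failure if and only if the number of agents is at most the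
number of undominated items, for each set of at most two items for which this number exceeds the
bound. -/
theorem eval_decision_fail {s : State} (hsucc : N .itemsSucc = N .items + 1)
    (hzero : s.ctr .zero = 0) (hfail : s.ctr .fail = 0) {T : ℕ → ℕ → Prop} (hrefl : ∀ a, T a a)
    (htrans : ∀ a b c, T a b → T b c → T a c)
    (hT : ∀ a < N .items, ∀ b < N .items, Edge N s a b → T a b)
    (hmin : ∀ Q : ℕ → ℕ → Prop, (∀ a < N .items, Q a a) →
      (∀ a < N .items, ∀ b < N .items, Edge N s a b → Q a b) →
      (∀ a < N .items, ∀ b < N .items, ∀ c < N .items, Q a b → Q b c → Q a c) →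
      ∀ a < N .items, ∀ b < N .items, T a b → Q a b)
    {ok : ℕ → Prop} (hok : ∀ c, ok c ↔
      (s.ctr .neg = 0 ∧ c ≤ hornerValue (s.arr .bitsD) (N .lenD)) ∨
        hornerValue (s.arr .bitsK) (N .lenK) ≤ c) :
    (decision.eval N s).ctr .fail = 0 ↔ ok (N .items) ∧ ∀ a < N .items, ∀ b < N .items,
      ok ((Finset.range (N .items)).filter fun w => ¬ T a w ∧ ¬ T b w).card := by
  simp only [decision, eval_seq]
  obtain ⟨k₁, d₁⟩ := eval_readNumbers (N := N) s hzero
  set s₁ := readNumbers.eval N s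
  have g₁ : s₁.arr .graph = s.arr .graph := eval_arr_of_changesArr (by rfl) _
  have f₁ : s₁.ctr .fail = s.ctr .fail := eval_ctr_of_changesCtr (by rfl) _
  have hE : ∀ {a b}, a < N .items → b < N .items → (Edge N (closure.eval N s₁) a b ↔ T a b) := by
    intro a b ha hb
    refine edge_eval_closure_iff s₁ hrefl htrans ?_ ?_ ha hb
    · simpa only [edge_congr g₁] using hT
    · simpa only [edge_congr g₁] using hmin
  set s₂ := closure.eval N s₁
  have f₂ : s₂.ctr .fail = 0 := ((eval_ctr_of_changesCtr (by rfl) _).trans f₁).trans hfail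
  have k₂ : s₂.ctr .agents = s₁.ctr .agents := eval_ctr_of_changesCtr (by rfl) _
  have d₂ : s₂.ctr .bound = s₁.ctr .bound := eval_ctr_of_changesCtr (by rfl) _
  -- Truncation at `N .items + 1` does not affect comparisons with numbers `c ≤ N .items`.
  have hok' : ∀ c ≤ N .items, ok c ↔ ¬ (c < s₁.ctr .agents ∧ ¬ c < s₁.ctr .bound) := by
    intro c hc
    rw [hok, k₁, d₁]
    split_ifs with h
    · simp only [h, true_and]
      omega
    · simp only [h, false_and, false_or]
      omega
  have f₃ : (checkEmpty.eval N s₂).ctr .fail = 0 ↔ ok (N .items) := by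
    rw [checkEmpty, eval_seq, eval_check_fail, hok' _ le_rfl, ← k₂, ← d₂]
    have h1 : ((seq (clear .count) (loop .items (inc .count))).eval N s₂).ctr .count
        = N .items := by
      refine eval_loop_invariant (N := N) (fun (j : ℕ) (s' : State) => s'.ctr .count = j) ?_ ?_
      · simp [eval_clear]
      · rintro j - s' h
        simp [eval_inc, h]
    have h2 : ∀ z, z ≠ .count →
        ((seq (clear .count) (loop .items (inc .count))).eval N s₂).ctr z = s₂.ctr z := fun z hz =>
      eval_ctr_of_changesCtr (by simp [changesCtr, hz]) _
    rw [h1, h2 _ (by simp), h2 _ (by simp), h2 _ (by simp)]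
    simp [f₂]
  have k₃ : (checkEmpty.eval N s₂).ctr .agents = s₁.ctr .agents :=
    (eval_ctr_of_changesCtr (by rfl) _).trans k₂
  have d₃ : (checkEmpty.eval N s₂).ctr .bound = s₁.ctr .bound :=
    (eval_ctr_of_changesCtr (by rfl) _).trans d₂
  have g₃ : (checkEmpty.eval N s₂).arr .graph = s₂.arr .graph :=
    eval_arr_of_changesArr (by rfl) _
  let cnt : ℕ → ℕ → ℕ := fun a b =>
    ((Finset.range (N .items)).filter fun w => ¬ T a w ∧ ¬ T b w).card
  -- No failure so far means that the empty set and all pairs lexicographically before `(k, l)` pass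
  -- the test.
  let J : ℕ → ℕ → State → Prop := fun k l s' => s'.ctr .agents = s₁.ctr .agents ∧
    s'.ctr .bound = s₁.ctr .bound ∧ s'.arr .graph = s₂.arr .graph ∧
    (s'.ctr .fail = 0 ↔ ok (N .items) ∧ ∀ a < N .items, ∀ b < N .items,
      a < k ∨ a = k ∧ b < l → ok (cnt a b))
  have key : J (N .items) 0 (checkPairs.eval N (checkEmpty.eval N s₂)) := by
    refine eval_forLoop_invariant (N := N) (fun k s' => J k 0 s') ?_ ?_ (by rfl) ?_
    · intro k s' v h
      simpa [J] using h
    · refine ⟨k₃, d₃, g₃, f₃.trans ?_⟩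
      simp
    · intro k hk s' hs' hu
      have h := eval_forLoop_invariant (N := N) (c := .items) (x := .v)
        (P := seq countUndominated check) (s := s') (fun l s' => s'.ctr .u = k ∧ J k l s')
        (fun k s' v h => by simpa [J] using h) ⟨hu, hs'⟩ (by rfl) (by
          rintro l hl s' ⟨hu, hk', hd', hg', h⟩ hv
          refine ⟨(eval_ctr_of_changesCtr (by rfl) _).trans hu,
            (eval_ctr_of_changesCtr (by rfl) _).trans hk',
            (eval_ctr_of_changesCtr (by rfl) _).trans hd',
            (eval_arr_of_changesArr (by rfl) _).trans hg', ?_⟩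
          have hcnt : (countUndominated.eval N s').ctr .count = cnt k l := by
            rw [eval_countUndominated s' (by omega) (by omega), hu, hv]
            refine congrArg Finset.card (Finset.filter_congr fun w hw => ?_)
            have hw := Finset.mem_range.1 hw
            rw [edge_congr hg', edge_congr hg', hE hk hw, hE hl hw]
          have hle : cnt k l ≤ N .items :=
            (Finset.card_filter_le _ _).trans (Finset.card_range _).le
          have hctr : ∀ z, countUndominated.changesCtr z = false →
              (countUndominated.eval N s').ctr z = s'.ctr z := fun z hz =>
            eval_ctr_of_changesCtr hz s'
          rw [eval_seq, eval_check_fail, hcnt, hctr .fail (by rfl), hctr .agents (by rfl),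
            hctr .bound (by rfl), hk', hd', ← hok' _ hle, h]
          constructor
          · rintro ⟨⟨h1, h2⟩, h3⟩
            refine ⟨h1, fun a ha b hb hab => ?_⟩
            by_cases hkl : a = k ∧ b = l
            · rw [hkl.1, hkl.2]
              exact h3
            · exact h2 a ha b hb (by omega)
          · rintro ⟨h1, h2⟩
            exact ⟨⟨h1, fun a ha b hb hab => h2 a ha b hb (by omega)⟩,
              h2 k hk l hl (Or.inr ⟨rfl, by omega⟩)⟩)
      refine ⟨h.2.1, h.2.2.1, h.2.2.2.1, h.2.2.2.2.trans (and_congr_right fun _ => ?_)⟩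
      exact ⟨fun h a ha b hb hab => h a ha b hb (by omega),
        fun h a ha b hb hab => h a ha b hb (by omega)⟩
  refine key.2.2.2.trans (and_congr_right fun _ => ?_)
  exact ⟨fun h a ha b hb => h a ha b hb (Or.inl ha), fun h a ha b hb _ => h a ha b hb⟩

end CGDecision

namespace CGDecision

open Computability StackProg

/-! ### Reading the input -/

/-- The stacks of the machine. -/
abbrev Key : Type := Reg Cst Ctr Arr

/-- Structured programs of the machine. -/
abbrev SProg : Type := StackProg Γ' Key

/-- The next symbol is a bit. -/
def isBit : Option Γ' → Bool
  | some (.bit _) => true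
  | _ => false

/-- The next symbol is the bit `1`. -/
def isOne : Option Γ' → Bool
  | some (.bit true) => true
  | _ => false

/-- The next symbol is a comma. -/
def isComma : Option Γ' → Bool
  | some .comma => true
  | _ => false

/-- Read a word of bits, and its length. -/
def readBits (y : Arr) (l : Cst) : SProg :=
  .loopIn isBit (.seq (.iteIn isOne (.push (.arr y) true) (.push (.arr y) false))
    (.seq (.push (.cst l) true) .popIn))

/-- Read the sign bit. -/
def readSign : SProg := .seq (.iteIn isOne (.push (.ctr .neg) true) .skip) .popIn

/-- Read the adjacency matrix; its entries are stored in reverse order. -/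
def readMatrix : SProg :=
  .loopIn Option.isSome (.seq
    (.iteIn isComma (.seq (.push (.cst .items) true) (.push (.cst .itemsSucc) true))
      (.iteIn isOne (.push .tmp₁ true) (.push .tmp₁ false))) .popIn)

/-- Bring the entries of the adjacency matrix into the right order. -/
def reverseMatrix : SProg :=
  .loop .tmp₁ Option.isSome (.seq (.ite .tmp₁ (fun o => o == some true)
    (.push (.arr .graph) true) (.push (.arr .graph) false)) (.pop .tmp₁))

/-- Read the input. -/
def readInput : SProg :=
  .seq (readBits .bitsK .lenK) (.seq .popIn (.seq readSign (.seq (readBits .bitsD .lenD)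
    (.seq .popIn (.seq readMatrix (.seq reverseMatrix (.push (.cst .itemsSucc) true)))))))

theorem _root_.StackProg.Exec.congr_right {A K : Type} [DecidableEq K] {P : StackProg A K}
    {S S' S'' : Stacks A K} {t : ℕ} (h : Exec P S S' t) (hS : S' = S'') : Exec P S S'' t :=
  hS ▸ h

theorem exec_push_bit {k : Key} (b : Bool) (w : List Γ') (F : Key → List Bool) :
    Exec (.iteIn isOne (.push k true) (.push k false)) (.bit b :: w, F)
      (.bit b :: w, Function.update F k (b :: F k)) 2 := by
  cases b
  · exact .iteIn_false rfl (.push k false _)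
  · exact .iteIn_true rfl (.push k true _)

/-- Pushing reverses the word: the input has its least significant bit first, so the most
significant bit ends on top, as Horner's method requires. -/
theorem exec_readBits (y : Arr) (l : Cst) (bits : List Bool) (w : List Γ')
    (hw : isBit w.head? = false) (F : Key → List Bool) :
    Exec (readBits y l) (bits.map Γ'.bit ++ w, F) (w, Function.update (Function.update F (.arr y)
      (bits.reverse ++ F (.arr y))) (.cst l) (List.replicate bits.length true ++ F (.cst l)))
      (5 * bits.length + 1) := by
  induction bits generalizing F with
  | nil => simpa [readBits] using Exec.loopIn_false (p := isBit) (S := (w, F)) hw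
  | cons b bits ih =>
    let F₁ : Key → List Bool := Function.update F (.arr y) (b :: F (.arr y))
    let F₂ : Key → List Bool := Function.update F₁ (.cst l) (true :: F₁ (.cst l))
    have h : Exec (readBits y l) (.bit b :: (bits.map Γ'.bit ++ w), F) _ _ :=
      Exec.loopIn_true (p := isBit) rfl ((exec_push_bit (k := .arr y) b
        (bits.map Γ'.bit ++ w) F).seq ((Exec.push (Reg.cst l) true _).seq (Exec.popIn _))) (ih F₂)
    rw [show 5 * (b :: bits).length + 1 = 1 + (2 + (1 + 1)) + (5 * bits.length + 1) by
      rw [List.length_cons]; ring]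
    refine h.congr_right (Prod.ext rfl ?_)
    funext k
    simp only [F₁, F₂]
    by_cases h₁ : k = .cst l
    · subst h₁
      simp [List.replicate_succ']
    · by_cases h₂ : k = .arr y
      · subst h₂
        simp
      · simp [h₁, h₂]

theorem exec_readSign (b : Bool) (w : List Γ') (F : Key → List Bool) :
    Exec readSign (.bit b :: w, F)
      (w, Function.update F (.ctr .neg) (List.replicate b.toNat true ++ F (.ctr .neg))) 3 := by
  cases b
  · have : Function.update F (.ctr .neg) (List.replicate 0 true ++ F (.ctr .neg)) = F := by simp
    rw [Bool.toNat_false, this]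
    exact (Exec.iteIn_false rfl (.skip _)).seq (.popIn _)
  · exact (Exec.iteIn_true rfl (.push _ true _)).seq (.popIn _)

/-- The value of a bit. -/
def bit? : Γ' → Option Bool
  | .bit b => some b
  | _ => none

/-- Each row ends with a comma, so the commas count the items, and the bits alone form the matrix.
-/
theorem exec_readMatrix (w : List Γ') (hw : ∀ c ∈ w, c = .comma ∨ ∃ b, c = .bit b)
    (F : Key → List Bool) : ∃ t ≤ 5 * w.length + 1, Exec readMatrix (w, F)
      ([], Function.update (Function.update (Function.update F
        .tmp₁ ((w.filterMap bit?).reverse ++ F .tmp₁))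
        (.cst .items) (List.replicate (w.count .comma) true ++ F (.cst .items)))
        (.cst .itemsSucc) (List.replicate (w.count .comma) true ++ F (.cst .itemsSucc))) t := by
  induction w generalizing F with
  | nil => exact ⟨1, by simp, by
    simpa [readMatrix] using Exec.loopIn_false (p := Option.isSome) rfl⟩
  | cons c w ih =>
    rcases hw c (by simp) with rfl | ⟨b, rfl⟩
    · obtain ⟨t, ht, h⟩ := ih (fun c hc => hw c (by simp [hc])) (Function.update (Function.update F
        (.cst .items) (true :: F (.cst .items))) (.cst .itemsSucc) (true :: F (.cst .itemsSucc)))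
      have e : Exec (.iteIn isComma (.seq (.push (.cst .items) true) (.push (.cst .itemsSucc) true))
          (.iteIn isOne (.push .tmp₁ true) (.push .tmp₁ false))) (.comma :: w, F)
          (.comma :: w, Function.update (Function.update F
        (.cst .items) (true :: F (.cst .items))) (.cst .itemsSucc) (true :: F (.cst .itemsSucc)))
          (1 + (1 + 1)) :=
        .iteIn_true rfl ((Exec.push _ true (Γ'.comma :: w, F)).seq (Exec.push _ true _))
      have h' : Exec readMatrix (.comma :: w, F) _ _ :=
        Exec.loopIn_true (p := Option.isSome) rfl (e.seq (.popIn _)) h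
      refine ⟨_, ?_, h'.congr_right ?_⟩
      rotate_left
      · refine Prod.ext rfl ?_
        funext k
        by_cases h₁ : k = .cst .items
        · subst h₁
          simp [List.replicate_succ']
        by_cases h₂ : k = .cst .itemsSucc
        · subst h₂
          simp [List.replicate_succ']
        by_cases h₃ : k = .tmp₁
        · subst h₃
          simp [bit?, List.filterMap_cons]
        · simp [h₁, h₂, h₃]
      · simp only [List.length_cons]
        omega
    · obtain ⟨t, ht, h⟩ := ih (fun c hc => hw c (by simp [hc])) (Function.update F
        .tmp₁ (b :: F .tmp₁))
      have e : Exec (.iteIn isComma (.seq (.push (.cst .items) true) (.push (.cst .itemsSucc) true))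
          (.iteIn isOne (.push .tmp₁ true) (.push .tmp₁ false))) (.bit b :: w, F)
          (.bit b :: w, Function.update F .tmp₁ (b :: F .tmp₁)) (1 + 2) :=
        .iteIn_false rfl (exec_push_bit b w F)
      have h' : Exec readMatrix (.bit b :: w, F) _ _ :=
        Exec.loopIn_true (p := Option.isSome) rfl (e.seq (.popIn _)) h
      refine ⟨_, ?_, h'.congr_right ?_⟩
      rotate_left
      · refine Prod.ext rfl ?_
        funext k
        by_cases h₁ : k = .cst .items
        · subst h₁
          simp
        by_cases h₂ : k = .cst .itemsSucc
        · subst h₂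
          simp
        by_cases h₃ : k = .tmp₁
        · subst h₃
          simp [bit?]
        · simp [h₁, h₂, h₃]
      · simp only [List.length_cons]
        omega

theorem exec_reverseMatrix (w : List Γ') (F : Key → List Bool) :
    Exec reverseMatrix (w, F) (w, Function.update (Function.update F .tmp₁ []) (.arr .graph)
      ((F .tmp₁).reverse ++ F (.arr .graph))) (4 * (F .tmp₁).length + 1) := by
  induction hl : F .tmp₁ generalizing F with
  | nil =>
    have : Function.update (Function.update F .tmp₁ []) (.arr .graph)
        ([].reverse ++ F (.arr .graph)) = F := by
      funext k
      by_cases h₁ : k = .arr .graph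
      · subst h₁
        simp
      by_cases h₂ : k = .tmp₁
      · subst h₂
        simp [hl]
      · simp [h₁, h₂]
    rw [this]
    exact .loop_false (by simp [hl])
  | cons b l ih =>
    obtain ⟨S, e, h1, h2⟩ := exec_move_bit (y := .tmp₁) (y' := .arr .graph) (w, F)
    obtain ⟨w', F'⟩ := S
    obtain rfl : w' = w := h1
    change F' = Function.update F (.arr .graph) ((F .tmp₁).getD 0 false :: F (.arr .graph)) at h2
    subst h2
    let F₁ : Key → List Bool :=
      Function.update F (.arr .graph) ((F .tmp₁).getD 0 false :: F (.arr .graph))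
    have h : Exec reverseMatrix (w', F) _ _ :=
      Exec.loop_true (p := Option.isSome) (k := Reg.tmp₁) (by simp [hl])
        (e.seq (Exec.pop Reg.tmp₁ _)) (ih (Function.update F₁ .tmp₁ (F₁ .tmp₁).tail)
          (by simp [F₁, hl]))
    rw [show 4 * (b :: l).length + 1 = 1 + (2 + 1) + (4 * l.length + 1) by
      rw [List.length_cons]; ring]
    refine h.congr_right (Prod.ext rfl ?_)
    funext k
    simp only [F₁]
    by_cases h₁ : k = .arr .graph
    · subst h₁
      simp [hl]
    by_cases h₂ : k = .tmp₁
    · subst h₂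
      simp
    · simp [h₁, h₂]

/-- The stacks after reading the input. -/
def inputStacks (kbits : List Bool) (sign : Bool) (dbits : List Bool) (g : List Γ') :
    Key → List Bool
  | .cst .items => List.replicate (g.count .comma) true
  | .cst .itemsSucc => List.replicate (g.count .comma + 1) true
  | .cst .lenK => List.replicate kbits.length true
  | .cst .lenD => List.replicate dbits.length true
  | .ctr .neg => List.replicate sign.toNat true
  | .arr .bitsK => kbits.reverse
  | .arr .bitsD => dbits.reverse
  | .arr .graph => g.filterMap bit?
  | _ => []

/-- The factor `9` is due to the matrix, whose symbols cost up to five steps to read and four to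
reverse. -/
theorem exec_readInput (kbits : List Bool) (sign : Bool) (dbits : List Bool) (g : List Γ')
    (hg : ∀ c ∈ g, c = .comma ∨ ∃ b, c = .bit b) :
    ∃ t ≤ 9 * (kbits.length + dbits.length + g.length) + 12, Exec readInput
      (kbits.map Γ'.bit ++ .comma :: .bit sign :: (dbits.map Γ'.bit ++ .comma :: g), fun _ => [])
      ([], inputStacks kbits sign dbits g) t := by
  let F₁ : Key → List Bool := Function.update (Function.update (fun _ => []) (.arr .bitsK)
    (kbits.reverse ++ [])) (.cst .lenK) (List.replicate kbits.length true ++ [])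
  let F₂ : Key → List Bool := Function.update F₁ (.ctr .neg)
    (List.replicate sign.toNat true ++ F₁ (.ctr .neg))
  let F₄ : Key → List Bool := Function.update (Function.update F₂ (.arr .bitsD)
    (dbits.reverse ++ F₂ (.arr .bitsD))) (.cst .lenD)
    (List.replicate dbits.length true ++ F₂ (.cst .lenD))
  have e₁ := exec_readBits .bitsK .lenK kbits (.comma :: .bit sign :: (dbits.map Γ'.bit ++
    .comma :: g)) rfl (fun _ => [])
  have e₂ := exec_readSign sign (dbits.map Γ'.bit ++ .comma :: g) F₁
  have e₃ := exec_readBits .bitsD .lenD dbits (.comma :: g) rfl F₂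
  obtain ⟨t, ht, e₄⟩ := exec_readMatrix g hg F₄
  have e₅ := exec_reverseMatrix [] (Function.update (Function.update (Function.update F₄ .tmp₁
    ((g.filterMap bit?).reverse ++ F₄ .tmp₁))
    (.cst .items) (List.replicate (g.count .comma) true ++ F₄ (.cst .items)))
    (.cst .itemsSucc) (List.replicate (g.count .comma) true ++ F₄ (.cst .itemsSucc)))
  have e : Exec readInput (kbits.map Γ'.bit ++ .comma :: .bit sign :: (dbits.map Γ'.bit ++
      .comma :: g), fun _ => []) _ _ := e₁.seq ((Exec.popIn _).seq (e₂.seq (e₃.seq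
    ((Exec.popIn _).seq (e₄.seq (e₅.seq (Exec.push (Reg.cst Cst.itemsSucc) true _)))))))
  refine ⟨_, ?_, e.congr_right ?_⟩
  rotate_left
  · refine Prod.ext rfl ?_
    funext k
    simp only [F₄, F₂, F₁]
    rcases k with - | - | - | - | c | x | y
    · simp [inputStacks]
    · simp [inputStacks]
    · simp [inputStacks]
    · simp [inputStacks]
    · cases c <;> simp [inputStacks, List.replicate_succ]
    · cases x <;> simp [inputStacks]
    · cases y <;> simp [inputStacks]
  · have := List.length_filterMap_le bit? g
    simp [F₄, F₂, F₁]
    omega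

/-! ### Output -/

/-- Empty a list of stacks. -/
def clearAll : List Key → SProg
  | [] => .skip
  | k :: ks => .seq (.clear k) (clearAll ks)

/-- Write the answer, and empty all other stacks. -/
noncomputable def writeOutput : SProg :=
  .seq (.ite (.ctr .fail) Option.isSome (.push .out false) (.push .out true))
    (clearAll (Finset.univ.erase .out).toList)

theorem exec_clearAll (ks : List Key) (w : List Γ') (F : Key → List Bool) (B : ℕ)
    (hB : ∀ k ∈ ks, (F k).length ≤ B) : ∃ t ≤ ks.length * (2 * B + 1) + 1,
      Exec (clearAll ks) (w, F) (w, fun k => if k ∈ ks then [] else F k) t := by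
  induction ks generalizing F with
  | nil => exact ⟨1, by simp, by simpa [clearAll] using Exec.skip (w, F)⟩
  | cons k ks ih =>
    obtain ⟨t, ht, h⟩ := ih (Function.update F k []) (fun j hj => by
      by_cases hjk : j = k
      · subst hjk
        simp
      · simpa [hjk] using hB j (by simp [hj]))
    have h' : Exec (clearAll (k :: ks)) (w, F) _ _ := (exec_clear k (w, F)).seq h
    refine ⟨_, ?_, h'.congr_right ?_⟩
    rotate_left
    · refine Prod.ext rfl ?_
      funext j
      by_cases hjk : j = k
      · subst hjk
        simp
      · simp [hjk]
    · have := hB k (by simp)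
      rw [List.length_cons, add_mul]
      dsimp only
      omega

/-- A halting configuration in the sense of `Turing.haltList` has all stacks except the output
empty, which is why the working stacks are cleared. -/
theorem exec_writeOutput {N : Cst → ℕ} {F : Key → List Bool} {s : State} (hF : LoopProg.Rep N [] F s)
    (B : ℕ) (hB : ∀ k, k ≠ .ctl → (F k).length ≤ B) :
    ∃ t ≤ Fintype.card Key * (2 * B + 1) + 3, Exec writeOutput (([], F) : Stacks Γ' Key)
      ([], Function.update (fun _ => []) .out [decide (s.ctr .fail = 0)]) t := by
  have e : Exec (.ite (.ctr .fail) Option.isSome (.push .out false) (.push .out true))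
      (([], F) : Stacks Γ' Key) ([], Function.update F .out [decide (s.ctr .fail = 0)]) 2 := by
    by_cases h : s.ctr .fail = 0
    · have := Exec.ite_false (p := Option.isSome) (k := Reg.ctr Ctr.fail)
        (P := .push .out false) (by simp [hF.ctr, h])
        (Exec.push .out true (([], F) : Stacks Γ' Key))
      simpa [h, hF.out] using this
    · have := Exec.ite_true (p := Option.isSome) (k := Reg.ctr Ctr.fail)
        (Q := .push .out true) (by simp [hF.ctr, h, List.head?_replicate])
        (Exec.push .out false (([], F) : Stacks Γ' Key))
      simpa [h, hF.out] using this
  obtain ⟨t, ht, h⟩ := exec_clearAll (Finset.univ.erase .out).toList [] (Function.update F .out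
    [decide (s.ctr .fail = 0)]) B (fun k hk => by
      have hk' : k ≠ .out := by simpa using hk
      by_cases hc : k = .ctl
      · simp [hc, hF.ctl]
      · simpa [hk'] using hB k hc)
  have h' : Exec writeOutput (([], F) : Stacks Γ' Key) _ _ := e.seq h
  refine ⟨_, ?_, h'.congr_right ?_⟩
  rotate_left
  · refine Prod.ext rfl ?_
    funext k
    by_cases hk : k = .out
    · subst hk
      simp
    · simp [hk]
  · rw [Finset.length_toList, Finset.card_erase_of_mem (Finset.mem_univ _), Finset.card_univ] at ht
    have := Nat.mul_le_mul_right (2 * B + 1) (Nat.sub_le (Fintype.card Key) 1)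
    omega

end CGDecision

namespace CGDecision

open Computability StackProg

/-! ### The machine -/

/-- The values of the read-only registers. -/
def sizes (kbits dbits : List Bool) (g : List Γ') : Cst → ℕ
  | .items => g.count .comma
  | .itemsSucc => g.count .comma + 1
  | .lenK => kbits.length
  | .lenD => dbits.length

/-- The state after reading the input. -/
def inputState (kbits : List Bool) (sign : Bool) (dbits : List Bool) (g : List Γ') : State where
  ctr := Function.update (fun _ => 0) .neg sign.toNat
  arr y i := (inputStacks kbits sign dbits g (.arr y)).getD i false

theorem rep_inputStacks (kbits : List Bool) (sign : Bool) (dbits : List Bool) (g : List Γ') :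
    LoopProg.Rep (sizes kbits dbits g) [] (inputStacks kbits sign dbits g)
      (inputState kbits sign dbits g) where
  out := rfl
  ctl := rfl
  tmp₁ := rfl
  tmp₂ := rfl
  cst c := by cases c <;> rfl
  ctr x := by cases x <;> simp [inputStacks, inputState]
  arr _ _ := rfl

/-- The program of the machine. -/
noncomputable def solver : SProg := .seq readInput (.seq decision.compile writeOutput)

/-- A bound for the running time of the machine. -/
noncomputable def solverTime : Polynomial ℕ :=
  9 * .X + decision.weight * (.X + decision.weight + 1) +
    (.C (Fintype.card Key) * (2 * (.X + decision.weight) + 1) + 3)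

/-- The input length bounds both the read-only registers and the initial stack heights, so
`decision.weight` at this length controls the main phase. -/
theorem exec_solver (kbits : List Bool) (sign : Bool) (dbits : List Bool) (g : List Γ')
    (hg : ∀ c ∈ g, c = .comma ∨ ∃ b, c = .bit b) {w : List Γ'}
    (hw : w = kbits.map Γ'.bit ++ .comma :: .bit sign :: (dbits.map Γ'.bit ++ .comma :: g)) :
    ∃ t ≤ solverTime.eval w.length, Exec solver (w, fun _ => [])
      ([], Function.update (fun _ => []) .out [decide ((decision.eval (sizes kbits dbits g)
        (inputState kbits sign dbits g)).ctr .fail = 0)]) t := by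
  have hlen : w.length = kbits.length + dbits.length + g.length + 3 := by
    simp [hw]
    ring
  have hcount : g.count .comma ≤ g.length := List.count_le_length
  have hfilter : (g.filterMap bit?).length ≤ g.length := List.length_filterMap_le bit? g
  have hsign : sign.toNat ≤ 1 := Bool.toNat_le sign
  obtain ⟨t₁, ht₁, e₁⟩ := exec_readInput kbits sign dbits g hg
  obtain ⟨F, t₂, e₂, hF, hlenF, ht₂⟩ := LoopProg.exec_compile decision []
    (inputStacks kbits sign dbits g) (inputState kbits sign dbits g) w.length w.length
    (w.length + decision.weight.eval w.length) ([] : List Γ') (rep_inputStacks kbits sign dbits g)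
    (fun c => by cases c <;> simp only [sizes] <;> omega)
    (fun k _ => by
      rcases k with - | - | - | - | c | x | y
      · simp [inputStacks]
      · simp [inputStacks]
      · simp [inputStacks]
      · simp [inputStacks]
      · cases c <;> simp only [inputStacks, List.length_replicate] <;> omega
      · cases x <;> simp only [inputStacks, List.length_replicate, List.length_nil] <;> omega
      · cases y <;> simp only [inputStacks, List.length_reverse] <;> omega) le_rfl
  obtain ⟨t₃, ht₃, e₃⟩ := exec_writeOutput hF _ hlenF
  refine ⟨_, ?_, hw ▸ e₁.seq (e₂.seq e₃)⟩
  simp only [solverTime, Polynomial.eval_add, Polynomial.eval_mul, Polynomial.eval_X,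
    Polynomial.eval_C, Polynomial.eval_one, Polynomial.eval_ofNat]
  omega

/-! ### The values of binary words -/

theorem hornerValue_congr {a a' : ℕ → Bool} {j : ℕ} (h : ∀ i < j, a i = a' i) :
    hornerValue a j = hornerValue a' j := by
  induction j with
  | zero => rfl
  | succ j ih => rw [hornerValue, hornerValue, ih fun i hi => h i (by omega), h j (by omega)]

/-- Horner's method from the most significant bit adds the least significant bit last, just as the
right fold over the unreversed word does. -/
theorem hornerValue_reverse (l : List Bool) : hornerValue (fun i => l.reverse.getD i false) l.length =
    l.foldr (fun b v => 2 * v + b.toNat) 0 := by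
  induction l with
  | nil => rfl
  | cons b l ih =>
    rw [List.foldr_cons, ← ih, List.length_cons, hornerValue]
    congr 2
    · refine hornerValue_congr fun i hi => ?_
      simp [List.getElem?_append_left, hi]
    · simp

theorem foldr_encodePosNum (m : PosNum) :
    (encodePosNum m).foldr (fun b v => 2 * v + b.toNat) 0 = (m : ℕ) := by
  induction m with
  | one => rfl
  | bit1 m ih =>
    rw [encodePosNum, List.foldr_cons, ih, PosNum.cast_bit1]
    simp [two_mul]
  | bit0 m ih =>
    rw [encodePosNum, List.foldr_cons, ih, PosNum.cast_bit0]
    simp [two_mul]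

theorem hornerValue_encodeNat (m : ℕ) : hornerValue (fun i => (encodeNat m).reverse.getD i false)
    (encodeNat m).length = m := by
  rw [hornerValue_reverse, encodeNat]
  conv_rhs => rw [← Num.to_of_nat m]
  cases (m : Num) with
  | zero => rfl
  | pos m => exact foldr_encodePosNum m

/-! ### The words of instances -/

/-- Rows of equal length `n` make the offset of row `i` equal to `i * n`; this is the address
computed by `position`. -/
theorem getD_flatMap {α β : Type} (l : List α) (f : α → List β) {n : ℕ}
    (hf : ∀ a, (f a).length = n) (d : β) (i : ℕ) (hi : i < l.length) (j : ℕ) (hj : j < n) :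
    (l.flatMap f).getD (i * n + j) d = (f l[i]).getD j d := by
  induction l generalizing i with
  | nil => simp at hi
  | cons a l ih =>
    rw [List.flatMap_cons]
    rcases i with - | i
    · rw [zero_mul, zero_add, List.getD_append _ _ _ _ (by rwa [hf])]
      rfl
    · rw [List.getD_append_right _ _ _ _ (by rw [hf, add_mul]; omega), hf,
        show (i + 1) * n + j - n = i * n + j by rw [add_mul]; omega,
        ih i (by simpa using hi)]
      rfl

section GraphWord

variable {n : ℕ} (G : Digraph (Fin n))

theorem count_comma_graphWord : (CGInstance.graphWord G).count .comma = n := by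
  classical
  have h (u : Fin n) :
      ((List.finRange n).map fun v => Γ'.bit (decide (G.Adj u v))).count .comma = 0 :=
    List.count_eq_zero.2 (by simp)
  simp [CGInstance.graphWord, List.count_flatMap, Function.comp_def, h]

theorem mem_graphWord {c : Γ'} (hc : c ∈ CGInstance.graphWord G) :
    c = .comma ∨ ∃ b, c = .bit b := by
  simp only [CGInstance.graphWord, List.mem_flatMap, List.mem_append, List.mem_map,
    List.mem_singleton] at hc
  obtain ⟨_, _, ⟨_, _, rfl⟩ | rfl⟩ := hc
  · exact .inr ⟨_, rfl⟩
  · exact .inl rfl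

theorem getD_filterMap_graphWord (u v : Fin n) :
    ((CGInstance.graphWord G).filterMap bit?).getD (u * n + v) false = true ↔ G.Adj u v := by
  classical
  have h : (CGInstance.graphWord G).filterMap bit? =
      (List.finRange n).flatMap fun u => (List.finRange n).map fun v => decide (G.Adj u v) := by
    rw [CGInstance.graphWord, List.filterMap_flatMap]
    congr 1
    funext u
    simp [List.filterMap_append, bit?, List.filterMap_map, Function.comp_def]
  rw [h, getD_flatMap (n := n) _ _ (by simp) _ _ (by simp) _ v.2]
  simp

theorem dissatisfaction_eq_card (S : Finset (Fin n)) (q : ℕ → Prop) [DecidablePred q]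
    (h : ∀ v : Fin n, q v ↔ ∀ u ∈ S, ¬ G.Reaches u v) :
    G.dissatisfaction S = ((Finset.range n).filter q).card := by
  rw [Digraph.dissatisfaction, ← Finset.card_map Fin.valEmbedding]
  congr 1
  ext v
  simp only [Finset.mem_map, Finset.mem_filter, Finset.mem_univ, true_and, Finset.mem_range,
    Fin.valEmbedding_apply, ← h]
  exact ⟨fun ⟨a, ha, hav⟩ => hav ▸ ⟨a.2, ha⟩, fun ⟨hv, hq⟩ => ⟨⟨v, hv⟩, hq, rfl⟩⟩

end GraphWord

/-! ### Correctness -/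

theorem decision_iff_isYes (I : CGInstance) (hI : I.graph.width ≤ 2) :
    (decision.eval (sizes (encodeNat I.agents) (encodeNat I.bound.natAbs)
      (CGInstance.graphWord I.graph)) (inputState (encodeNat I.agents) (decide (I.bound < 0))
      (encodeNat I.bound.natAbs) (CGInstance.graphWord I.graph))).ctr .fail = 0 ↔ I.IsYes := by
  classical
  set N := sizes (encodeNat I.agents) (encodeNat I.bound.natAbs)
    (CGInstance.graphWord I.graph) with hN
  set s := inputState (encodeNat I.agents) (decide (I.bound < 0))
      (encodeNat I.bound.natAbs) (CGInstance.graphWord I.graph) with hs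
  have hn : N .items = I.items := count_comma_graphWord I.graph
  have hedge (u v : Fin I.items) : Edge N s u v ↔ I.graph.Adj u v := by
    rw [Edge, hn]
    exact getD_filterMap_graphWord I.graph u v
  -- Reachability extended to all natural numbers. The universal quantifier over `ha` makes it
  -- reflexive also outside the range, and the existential one over `hb` keeps it transitive.
  let T (a b : ℕ) : Prop := ∀ ha : a < I.items, ∃ hb : b < I.items,
    I.graph.Reaches ⟨a, ha⟩ ⟨b, hb⟩
  let ok (c : ℕ) : Prop := (c : ℤ) ≤ I.bound ∨ I.agents ≤ c
  have hok (c : ℕ) : ok c ↔ (s.ctr .neg = 0 ∧ c ≤ hornerValue (s.arr .bitsD) (N .lenD)) ∨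
      hornerValue (s.arr .bitsK) (N .lenK) ≤ c := by
    have hD : hornerValue (s.arr .bitsD) (N .lenD) = I.bound.natAbs := hornerValue_encodeNat _
    have hK : hornerValue (s.arr .bitsK) (N .lenK) = I.agents := hornerValue_encodeNat _
    have hneg : s.ctr .neg = 0 ↔ ¬ I.bound < 0 := by
      simp [hs, inputState]
    rw [hD, hK, hneg]
    simp only [ok]
    omega
  have hT (u v : Fin I.items) : T u v ↔ I.graph.Reaches u v :=
    ⟨fun h => (h u.2).2, fun h _ => ⟨v.2, h⟩⟩
  have hcard (u v : Fin I.items) (S : Finset (Fin I.items)) (hS : ∀ w, w ∈ S ↔ w = u ∨ w = v)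
      {_ : DecidablePred fun w => ¬ T u w ∧ ¬ T v w} :
      ok ((Finset.range I.items).filter fun w => ¬ T u w ∧ ¬ T v w).card ↔
        ok (I.graph.dissatisfaction S) := by
    rw [dissatisfaction_eq_card I.graph S (fun w => ¬ T u w ∧ ¬ T v w) fun w => by simp [hT, hS]]
  have hempty : I.graph.dissatisfaction ∅ = I.items := by simp [Digraph.dissatisfaction]
  have hmin (Q : ℕ → ℕ → Prop) (hrefl : ∀ a < N .items, Q a a)
      (hadj : ∀ a < N .items, ∀ b < N .items, Edge N s a b → Q a b)
      (htrans : ∀ a < N .items, ∀ b < N .items, ∀ c < N .items, Q a b → Q b c → Q a c) :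
      ∀ a < N .items, ∀ b < N .items, T a b → Q a b := by
    rw [hn] at hrefl hadj htrans ⊢
    intro a ha b hb hab
    obtain ⟨_, hab⟩ := hab ha
    have h (v : Fin I.items) (hv : I.graph.Reaches ⟨a, ha⟩ v) : Q a v := by
      induction hv with
      | refl => exact hrefl a ha
      | tail _ h ih =>
        exact htrans _ ha _ (Fin.is_lt _) _ (Fin.is_lt _) ih
          (hadj _ (Fin.is_lt _) _ (Fin.is_lt _) ((hedge _ _).2 h))
    exact h _ hab
  have hadj (a : ℕ) (ha : a < N .items) (b : ℕ) (hb : b < N .items) (hab : Edge N s a b) : T a b :=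
    (hT ⟨a, hn ▸ ha⟩ ⟨b, hn ▸ hb⟩).2 (.single ((hedge _ _).1 hab))
  have htrans (a b c : ℕ) (hab : T a b) (hbc : T b c) : T a c := fun ha => by
    obtain ⟨hb, hab⟩ := hab ha
    obtain ⟨hc, hbc⟩ := hbc hb
    exact ⟨hc, hab.trans hbc⟩
  have key := eval_decision_fail (N := N) (s := s) rfl (by simp [hs, inputState])
    (by simp [hs, inputState]) (T := T) (fun a ha => ⟨ha, .refl⟩) htrans hadj hmin hok
  rw [key, hn]
  constructor
  · rintro ⟨h₀, h₂⟩
    refine I.graph.exists_allocation_of_le_dissatisfaction I.acyclic hI (by rwa [hempty]) ?_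
    rintro S ⟨u, v, hS⟩
    exact (hcard u v S hS).1 (h₂ u u.2 v v.2)
  · rintro ⟨π, hdis, hπ⟩
    -- An allocation makes every set of items pass the test, in particular those that the procedure
    -- inspects.
    have h (S : Finset (Fin I.items)) : ok (I.graph.dissatisfaction S) := by
      by_contra! hS
      exact hS (.inr (I.graph.le_dissatisfaction_of_allocation π hdis hπ S fun h => hS (.inl h)))
    refine ⟨hempty ▸ h ∅, fun a ha b hb => ?_⟩
    exact (hcard ⟨a, ha⟩ ⟨b, hb⟩ {⟨a, ha⟩, ⟨b, hb⟩} (by simp)).2 (h _)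

end CGDecision

theorem mainTheorem3 :
    SolvableInPolyTime
      (fun I : {I : CGInstance // I.graph.width ≤ 2} => I.1.word)
      (fun I : {I : CGInstance // I.graph.width ≤ 2} => I.1.IsYes) := by
  refine solvableInPolyTime_of_exec CGDecision.solver .out CGDecision.solverTime _
    (fun I => by rw [decide_eq_true_iff]; exact CGDecision.decision_iff_isYes I.1 I.2)
    fun I => CGDecision.exec_solver _ _ _ _ (fun c => CGDecision.mem_graphWord I.1.graph) ?_
  simp [CGInstance.word, CGInstance.natWord, CGInstance.intWord]
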